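/- **Setting.** Let $(\Omega,\mathcal F,P)$ be a probability space carrying random variables $x_t\in\mathbb R^N$ (state), $w_t\in\mathbb R^d$ (noise), $q_t\in\mathcal M$ and $q'_t\in\mathcal M'$ (channel input and output, with $\mathcal M,\mathcal M'$ finite), $t=0,1,2,\dots$, such that: * the $w_t$ are i.i.d. with law $\nu$, and $(w_t)_{t\ge0}$ is independent of $x_0$; * (plant) $x_{t+1}=f(x_t,w_t)+Bu_t$ with $u_t\in\mathbb R^s$ and $B\in\mathbb R^{N\times s}$, where $f:\mathbb R^N\times\mathbb R^d\to\mathbb R^N$ is Borel measurable and, for every $w$, the map $f(\cdot,w):\mathbb R^N\to\mathbb R^N$ is continuously differentiable and invertible (bijective); * (admissible coding and control policy) $q_t=\gamma^e_t(x_{[0,t]},q'_{[0,t-1]})$ and $u_t=\gamma_t(q'_{[0,t]})$ for measurable functions $\gamma^e_t,\gamma_t$, where $a_{[0,t]}=(a_0,\dots,a_t)$; * (channel) for every $t$ the conditional law of $q'_t$ given $q_{[0,t]},q'_{[0,t-1]},x_0,(w_r)_{r\ge0}$ is $\kappa_t(\,\cdot\mid q_{[0,t]},q'_{[0,t-1]})$,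 for given probability kernels $\kappa_t$; that is, the channel is arbitrary with memory and feedback, and depends on $x_0$ and $(w_r)$ only through its inputs and past outputs. **Notation.** Let $\pi_t$ be the law of $x_t$, and let $h(x_t)\in[-\infty,\infty]$ be its differential entropy $-\int p_t\log_2 p_t\,dx$ if $\pi_t$ has a Lebesgue density $p_t$, and $-\infty$ otherwise. The directed information is $$I(q_{[0,T-1]}\to q'_{[0,T-1]})=I(q_0;q'_0)+\sum_{t=1}^{T-1}I(q_{[0,t]};q'_t\mid q'_{[0,t-1]})$$ (in bits), and $|J(f(x,w))|$ is the absolute value of the determinant of the Jacobian matrix of $f(\cdot,w)$ at $x$, with $\log_2 0=-\infty$. Integrals of extended-real functions are $\int g^+-\int g^-$ with values in $[-\infty,\infty]$; in integrals and in sums, $\infty-\infty$ is read as $-\infty$. **Theorem (generalized Bode integral formula).** Suppose that $h(x_0)$ is finite and that $$\limsup_{t\to\infty}\frac{h(x_t)}{t}\le 0 .$$ Then $$\limsup_{T\to\infty}\frac1T\,I(q_{[0,T-1]}\to q'_{[0,T-1]})\;\ge\;\limsup_{T\to\infty}\frac1T\sum_{t=0}^{T-1}\iint\log_2|J(f(x,w))|\;(\pi_t\otimes\nu)(dx,dw).$$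 -/

import Mathlib

open MeasureTheory ProbabilityTheory Filter

namespace BodeFormula

noncomputable section

/-- The Euclidean space `ℝⁿ` with its Borel structure and Lebesgue measure. -/
abbrev Vec (n : ℕ) : Type := EuclideanSpace ℝ (Fin n)

/-- The integral `∫ g⁺ dμ - ∫ g⁻ dμ` of an extended-real function, with value in `[-∞, ∞]`.
It is the usual integral as soon as one of the two parts is finite; if both are infinite
the value is `-∞` (the `EReal` convention `⊤ - ⊤ = ⊥`). -/
def extIntegral {α : Type*} [MeasurableSpace α] (μ : Measure α) (g : α → EReal) : EReal :=
  ((∫⁻ a, (g a).toENNReal ∂μ : ENNReal) : EReal) -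
    ((∫⁻ a, (-(g a)).toENNReal ∂μ : ENNReal) : EReal)

/-- `log₂ |y|`, with the value `-∞` at `y = 0`. -/
def log2Abs (y : ℝ) : EReal :=
  open Classical in if y = 0 then ⊥ else ((Real.logb 2 |y| : ℝ) : EReal)

/-- Differential entropy in bits, `-∫ p log₂ p dx` with `p` the Lebesgue density of `μ`.
A law that is not absolutely continuous has differential entropy `-∞`. -/
def diffEntropy {n : ℕ} (μ : Measure (Vec n)) : EReal :=
  open Classical in
  if μ ≪ (volume : Measure (Vec n)) then
    extIntegral (volume : Measure (Vec n)) fun y =>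
      ((Real.negMulLog (μ.rnDeriv volume y).toReal / Real.log 2 : ℝ) : EReal)
  else ⊥

section Discrete

variable {Ω : Type*} [MeasurableSpace Ω]

/-- Shannon entropy `H(X) = -∑ p(s) log₂ p(s)` of a finitely valued random variable. -/
def entropy {S : Type*} [Fintype S] (P : Measure Ω) (X : Ω → S) : ℝ :=
  ∑ s, Real.negMulLog (P.real (X ⁻¹' {s})) / Real.log 2

/-- Conditional entropy `H(X | Z) = ∑ P(Z = z) H(X | Z = z)`. -/
def condEntropy {S U : Type*} [Fintype S] [Fintype U] (P : Measure Ω)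
    (X : Ω → S) (Z : Ω → U) : ℝ :=
  ∑ z, P.real (Z ⁻¹' {z}) * entropy (ProbabilityTheory.cond P (Z ⁻¹' {z})) X

/-- Conditional mutual information `I(X; Y | Z) = H(X | Z) - H(X | Y, Z)`. -/
def condMutualInfo {S S' U : Type*} [Fintype S] [Fintype S'] [Fintype U] (P : Measure Ω)
    (X : Ω → S) (Y : Ω → S') (Z : Ω → U) : ℝ :=
  condEntropy P X Z - condEntropy P X fun ω => (Y ω, Z ω)

/-- The first `t` terms `(a₀, …, a_{t-1})` of a random sequence. -/
def history {S : Type*} (a : ℕ → Ω → S) (t : ℕ) (ω : Ω) : Fin t → S := fun i => a i ω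

/-- Directed information
`I(q_{[0,T-1]} → q'_{[0,T-1]}) = ∑_{t < T} I(q_{[0,t]}; q'_t | q'_{[0,t-1]})`. In the term
`t = 0` the conditioning variable is the empty tuple, so that this term is `I(q₀; q'₀)`. -/
def directedInfo {M M' : Type*} [Fintype M] [Fintype M'] (P : Measure Ω)
    (q : ℕ → Ω → M) (q' : ℕ → Ω → M') (T : ℕ) : ℝ :=
  ∑ t ∈ Finset.range T, condMutualInfo P (history q (t + 1)) (q' t) (history q' t)

end Discrete

/-- A channel with memory and feedback: the conditional law of the output `q'_t`
given the inputs `q_{[0,t]}` and the past outputs `q'_{[0,t-1]}`. -/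
abbrev Channel (M M' : Type*) : Type _ :=
  ∀ t : ℕ, (Fin (t + 1) → M) → (Fin t → M') → PMF M'

/-- A causal coding policy: `q_t = γᵉ_t (x_{[0,t]}, q'_{[0,t-1]})`. -/
abbrev CodingPolicy (N : ℕ) (M M' : Type*) : Type _ :=
  ∀ t : ℕ, (Fin (t + 1) → Vec N) → (Fin t → M') → M

/-- A causal control policy: `u_t = γ_t (q'_{[0,t]})`. -/
abbrev ControlPolicy (s : ℕ) (M' : Type*) : Type _ :=
  ∀ t : ℕ, (Fin (t + 1) → M') → Vec s

/-- The processes `x, w, q, q'` on the probability space `(Ω, P)` form the closed loop of the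
system `x_{t+1} = f (x_t, w_t) + B u_t` with noise law `ν`, channel `ch` and
policies `γe`, `γ`. -/
structure IsClosedLoop {N d s : ℕ} {M M' : Type*} [MeasurableSpace M] [MeasurableSpace M']
    {Ω : Type*} [MeasurableSpace Ω] (P : Measure Ω)
    (f : Vec N → Vec d → Vec N) (B : Matrix (Fin N) (Fin s) ℝ) (ν : Measure (Vec d))
    (ch : Channel M M') (γe : CodingPolicy N M M') (γ : ControlPolicy s M')
    (x : ℕ → Ω → Vec N) (w : ℕ → Ω → Vec d) (q : ℕ → Ω → M) (q' : ℕ → Ω → M') : Prop where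
  measurable_init : Measurable (x 0)
  measurable_noise : ∀ t, Measurable (w t)
  measurable_output : ∀ t, Measurable (q' t)
  /-- The noise is i.i.d. with law `ν` and independent of the initial state. -/
  noise_law : ∀ t, P.map (w t) = ν
  noise_indep : iIndepFun w P
  init_indep : IndepFun (x 0) (fun ω t => w t ω) P
  /-- The plant. -/
  state_eq : ∀ t ω, x (t + 1) ω =
    f (x t ω) (w t ω) + Matrix.toEuclideanLin B (γ t (history q' (t + 1) ω))
  /-- The encoder. -/
  input_eq : ∀ t ω, q t ω = γe t (history x (t + 1) ω) (history q' t ω)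
  /-- The channel: conditionally on the initial state, the whole noise sequence, the inputs up to
  time `t` and the outputs before time `t`, the law of `q'_t` is the one given by the channel.
  In particular `q'_t ↔ (q_{[0,t]}, q'_{[0,t-1]}) ↔ (x₀, (w_r)_{r ≥ 0})` is a Markov chain. -/
  output_law : ∀ t b,
    P[(q' t ⁻¹' {b}).indicator (fun _ => (1 : ℝ)) |
      MeasurableSpace.comap
        (fun ω => ((x 0 ω, fun r => w r ω), (history q (t + 1) ω, history q' t ω)))
        inferInstance]
      =ᵐ[P] fun ω => (ch t (history q (t + 1) ω) (history q' t ω) b).toReal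

/-- `∫∫ log₂ |det J(f(x, w))| π(dx) ν(dw)`, where `J(f(x, w))` is the Jacobian of `f(·, w)`
at `x`. -/
def expLogJacobian {N d : ℕ} (f : Vec N → Vec d → Vec N)
    (π : Measure (Vec N)) (ν : Measure (Vec d)) : EReal :=
  extIntegral (π.prod ν) fun z => log2Abs (fderiv ℝ (fun y => f y z.2) z.1).det

end

end BodeFormula

/-! Fix a horizon T. For fixed channel outputs `b` and fixed noise the controls are constants, so
the map from x₀ to x_T is a composition of C¹ bijections and translations. By the chain rule its
Jacobian is the product J of the one-step Jacobians. Since the channel sees (x₀, w) only through its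
inputs, the conditional probability K of the outputs given (x₀, w) is a product of channel
probabilities, explicit in (x₀, w, b) (`setLIntegral_outputs`).

Let p₀ and p_T be the densities of x₀ and x_T, and put R = p_T(x_T) |J| P(q') / (p₀(x₀) K). In E[R],
summing over the outputs brings in the weight K, integrating over x₀ brings in p₀, and both cancel.
The change of variables then leaves ∑ P(q' = b) ∫ p_T ≤ 1 (`lintegral_state_mul_ratio_le`). Taking
expectations in log R ≤ R - 1 gives ∑ E log₂|J(f(x_t, w_t))| ≤ h(x_T) - h(x₀) + E log₂ (K / P(q')),
and the last expectation is exactly the directed information, by telescoping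
(`directedInfo_eq_integral`). Independence of x_t and w_t (`map_state_noise`) identifies the left
side with the integrals against π_t ⊗ ν. This is `sum_expLogJacobian_le`. Dividing by T and taking
the limsup removes h(x₀) and, by the growth hypothesis, h(x_T).

The rest of the work concerns infinite values: x_T must be shown to have a density
(`absolutelyContinuous_map_state`), and h(x_T) may be infinite (`sum_extIntegral_le`). -/

namespace BodeFormula

set_option linter.unusedSectionVars false

/-! ### Trajectories for prescribed outputs: causality, measurability, change of variables. -/

section Trajectory

variable {N d s : ℕ} {M M' : Type*}

/-- The state at time `t` as a function of the initial state, the noise sequence and the sequence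
of channel outputs. -/
noncomputable def stateOf (f : Vec N → Vec d → Vec N) (B : Matrix (Fin N) (Fin s) ℝ)
    (γ : ControlPolicy s M') (b : ℕ → M') (z : Vec N × (ℕ → Vec d)) : ℕ → Vec N
  | 0 => z.1
  | t + 1 => f (stateOf f B γ b z t) (z.2 t) + Matrix.toEuclideanLin B (γ t fun i => b i)

/-- The channel input at time `t` as a function of the initial state, the noise sequence and the
sequence of channel outputs. -/
noncomputable def inputOf (f : Vec N → Vec d → Vec N) (B : Matrix (Fin N) (Fin s) ℝ)
    (γe : CodingPolicy N M M') (γ : ControlPolicy s M') (b : ℕ → M')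
    (z : Vec N × (ℕ → Vec d)) (t : ℕ) : M :=
  γe t (fun i => stateOf f B γ b z i) fun i => b i

/-- The conditional probability, given the initial state and the noise, that the first `T`
channel outputs are those of the sequence `b`. -/
noncomputable def pathProb (f : Vec N → Vec d → Vec N) (B : Matrix (Fin N) (Fin s) ℝ)
    (ch : Channel M M') (γe : CodingPolicy N M M') (γ : ControlPolicy s M') (b : ℕ → M')
    (z : Vec N × (ℕ → Vec d)) (T : ℕ) : ENNReal :=
  ∏ t ∈ Finset.range T, ch t (fun i => inputOf f B γe γ b z i) (fun i => b i) (b t)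

/-- The Jacobian determinant of `f (·, v)` at `y`. -/
noncomputable def jacobian (f : Vec N → Vec d → Vec N) (y : Vec N) (v : Vec d) : ℝ :=
  (fderiv ℝ (fun y => f y v) y).det

/-- The absolute value of the Jacobian determinant of the map from the initial state to the
state at time `T`. -/
noncomputable def pathJacobian (f : Vec N → Vec d → Vec N) (B : Matrix (Fin N) (Fin s) ℝ)
    (γ : ControlPolicy s M') (b : ℕ → M') (z : Vec N × (ℕ → Vec d)) (T : ℕ) : ENNReal :=
  ∏ t ∈ Finset.range T, ENNReal.ofReal |jacobian f (stateOf f B γ b z t) (z.2 t)|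

variable {f : Vec N → Vec d → Vec N} {B : Matrix (Fin N) (Fin s) ℝ} {ch : Channel M M'}
  {γe : CodingPolicy N M M'} {γ : ControlPolicy s M'}

/-- Causality. Agreement of `b` before `t` reduces to finitely many output words; agreement of the
noise strictly before `t` is what later makes the state independent of `w t`. -/
lemma stateOf_congr {b b' : ℕ → M'} {z z' : Vec N × (ℕ → Vec d)} {t : ℕ} (h : z.1 = z'.1)
    (hw : ∀ i < t, z.2 i = z'.2 i) (hb : ∀ i < t, b i = b' i) :
    stateOf f B γ b z t = stateOf f B γ b' z' t := by
  induction t with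
  | zero => exact h
  | succ t ih =>
    have hγ : (fun i : Fin (t + 1) => b i) = fun i : Fin (t + 1) => b' i :=
      funext fun i => hb i i.2
    simp only [stateOf]
    rw [ih (fun i hi => hw i (by lia)) (fun i hi => hb i (by lia)), hw t (by lia), hγ]

lemma inputOf_congr {b b' : ℕ → M'} {z z' : Vec N × (ℕ → Vec d)} {t : ℕ} (h : z.1 = z'.1)
    (hw : ∀ i < t, z.2 i = z'.2 i) (hb : ∀ i < t, b i = b' i) :
    inputOf f B γe γ b z t = inputOf f B γe γ b' z' t := by
  have h₁ : (fun i : Fin (t + 1) => stateOf f B γ b z i) =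
      fun i : Fin (t + 1) => stateOf f B γ b' z' i :=
    funext fun i => stateOf_congr h (fun j hj => hw j (by lia)) fun j hj => hb j (by lia)
  have h₂ : (fun i : Fin t => b i) = fun i : Fin t => b' i := funext fun i => hb i i.2
  simp only [inputOf]
  rw [h₁, h₂]

lemma pathProb_congr {b b' : ℕ → M'} {z z' : Vec N × (ℕ → Vec d)} {T : ℕ} (h : z.1 = z'.1)
    (hw : ∀ i < T, z.2 i = z'.2 i) (hb : ∀ i < T, b i = b' i) :
    pathProb f B ch γe γ b z T = pathProb f B ch γe γ b' z' T := by
  refine Finset.prod_congr rfl fun t ht => ?_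
  rw [Finset.mem_range] at ht
  have h₁ : (fun i : Fin (t + 1) => inputOf f B γe γ b z i) =
      fun i : Fin (t + 1) => inputOf f B γe γ b' z' i :=
    funext fun i => inputOf_congr h (fun j hj => hw j (by lia)) fun j hj => hb j (by lia)
  have h₂ : (fun i : Fin t => b i) = fun i : Fin t => b' i := funext fun i => hb i (by lia)
  rw [h₁, h₂, hb t ht]

lemma pathJacobian_congr {b b' : ℕ → M'} {z : Vec N × (ℕ → Vec d)} {T : ℕ}
    (hb : ∀ i < T, b i = b' i) :
    pathJacobian f B γ b z T = pathJacobian f B γ b' z T := by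
  refine Finset.prod_congr rfl fun t ht => ?_
  rw [Finset.mem_range] at ht
  rw [stateOf_congr rfl (fun _ _ => rfl) fun j hj => hb j (hj.trans ht)]

/-- Joint measurability needs an argument because `f` is merely measurable in the noise. Directional
derivatives are pointwise limits of measurable difference quotients, and the determinant is a
polynomial in them. -/
lemma measurable_jacobian (hf : Measurable (Function.uncurry f))
    (hf_diff : ∀ v, ContDiff ℝ 1 fun y => f y v) :
    Measurable fun z : Vec N × Vec d => jacobian f z.1 z.2 := by
  have key : ∀ e : Vec N,
      Measurable fun z : Vec N × Vec d => fderiv ℝ (fun y => f y z.2) z.1 e := by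
    intro e
    refine measurable_of_tendsto_metrizable
      (f := fun (n : ℕ) (z : Vec N × Vec d) =>
        (n : ℝ) • (f (z.1 + (n : ℝ)⁻¹ • e) z.2 - f z.1 z.2)) (fun n => ?_) ?_
    · have h₁ : Measurable fun z : Vec N × Vec d => f (z.1 + (n : ℝ)⁻¹ • e) z.2 :=
        hf.comp ((measurable_fst.add_const _).prodMk measurable_snd)
      have h₂ : Measurable fun z : Vec N × Vec d => f z.1 z.2 := hf
      exact (h₁.sub h₂).const_smul (n : ℝ)
    · rw [tendsto_pi_nhds]
      intro z
      have hd : HasFDerivAt (fun y => f y z.2) (fderiv ℝ (fun y => f y z.2) z.1) z.1 :=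
        ((hf_diff z.2).differentiable (by norm_num) z.1).hasFDerivAt
      refine hd.lim e ?_
      simpa using tendsto_natCast_atTop_atTop (R := ℝ)
  have hdet : ∀ z : Vec N × Vec d, jacobian f z.1 z.2 =
      (Matrix.of fun i j : Fin N =>
        fderiv ℝ (fun y => f y z.2) z.1 (EuclideanSpace.single j 1) i).det := by
    intro z
    rw [jacobian, ContinuousLinearMap.det,
      ← LinearMap.det_toMatrix (EuclideanSpace.basisFun (Fin N) ℝ).toBasis]
    congr 1
  simp_rw [hdet, Matrix.det_apply]
  refine Finset.measurable_sum _ fun σ _ => ?_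
  refine Measurable.const_smul (Finset.measurable_prod _ fun i _ => ?_) _
  exact (EuclideanSpace.proj (𝕜 := ℝ) (σ i)).continuous.measurable.comp (key _)

lemma measurable_stateOf (hf : Measurable (Function.uncurry f)) (b : ℕ → M') (t : ℕ) :
    Measurable fun z => stateOf f B γ b z t := by
  induction t with
  | zero => exact measurable_fst
  | succ t ih =>
    exact (hf.comp (ih.prodMk ((measurable_pi_apply t).comp measurable_snd))).add_const _

lemma measurable_pathJacobian (hf : Measurable (Function.uncurry f))
    (hf_diff : ∀ v, ContDiff ℝ 1 fun y => f y v) (b : ℕ → M') (T : ℕ) :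
    Measurable fun z => pathJacobian f B γ b z T := by
  refine Finset.measurable_prod _ fun t _ => ?_
  have h := (measurable_jacobian hf hf_diff).comp
    ((measurable_stateOf (B := B) (γ := γ) hf b t).prodMk
      ((measurable_pi_apply t).comp measurable_snd))
  exact (measurable_norm.comp h).ennreal_ofReal

lemma measurable_inputOf [MeasurableSpace M] [MeasurableSpace M']
    (hf : Measurable (Function.uncurry f)) (hγe : ∀ t, Measurable (Function.uncurry (γe t)))
    (b : ℕ → M') (t : ℕ) : Measurable fun z => inputOf f B γe γ b z t :=
  (hγe t).comp
    ((measurable_pi_lambda _ fun i : Fin (t + 1) => measurable_stateOf hf b i).prodMk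
      measurable_const)

lemma measurable_pathProb [Finite M] [MeasurableSpace M] [MeasurableSingletonClass M]
    [MeasurableSpace M'] (hf : Measurable (Function.uncurry f))
    (hγe : ∀ t, Measurable (Function.uncurry (γe t))) (b : ℕ → M') (T : ℕ) :
    Measurable fun z => pathProb f B ch γe γ b z T := by
  refine Finset.measurable_prod _ fun t _ => ?_
  exact (Measurable.of_discrete (f := fun a : Fin (t + 1) → M => ch t a (fun i => b i) (b t))).comp
    (measurable_pi_lambda _ fun i : Fin (t + 1) => measurable_inputOf hf hγe b i)

/-- The area formula for an injective map, with image the whole space by surjectivity. The Jacobian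
is allowed to vanish. -/
lemma lintegral_comp_mul_jacobian (hf_diff : ∀ v, ContDiff ℝ 1 fun y => f y v)
    (hf_inv : ∀ v, Function.Bijective fun y => f y v) (v : Vec d) (g : Vec N → ENNReal) :
    ∫⁻ y, g (f y v) * ENNReal.ofReal |jacobian f y v| = ∫⁻ y, g y := by
  have h := lintegral_image_eq_lintegral_abs_det_fderiv_mul (volume : Measure (Vec N))
    (s := Set.univ) (f := fun y => f y v) (f' := fderiv ℝ fun y => f y v) MeasurableSet.univ
    (fun y _ => ((hf_diff v).differentiable (by norm_num) y).hasFDerivAt.hasFDerivWithinAt)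
    (hf_inv v).injective.injOn g
  rw [Set.image_univ, (hf_inv v).surjective.range_eq, Measure.restrict_univ] at h
  rw [h]
  exact lintegral_congr fun y => mul_comm _ _

/-- The last step is peeled off: its Jacobian factor is absorbed into the test function of the
induction hypothesis, and the control, constant for fixed `b`, disappears by translation invariance.
-/
lemma lintegral_stateOf_mul_pathJacobian
    (hf_diff : ∀ v, ContDiff ℝ 1 fun y => f y v)
    (hf_inv : ∀ v, Function.Bijective fun y => f y v) (b : ℕ → M') (w : ℕ → Vec d) (T : ℕ)
    (g : Vec N → ENNReal) :
    ∫⁻ y, g (stateOf f B γ b (y, w) T) * pathJacobian f B γ b (y, w) T = ∫⁻ y, g y := by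
  induction T generalizing g with
  | zero => simp [stateOf, pathJacobian]
  | succ T ih =>
    set c : Vec N := Matrix.toEuclideanLin B (γ T fun i => b i) with hc
    have h := ih fun y => g (f y (w T) + c) * ENNReal.ofReal |jacobian f y (w T)|
    rw [lintegral_comp_mul_jacobian hf_diff hf_inv (w T) fun y => g (y + c),
      lintegral_add_right_eq_self g c] at h
    rw [← h]
    refine lintegral_congr fun y => ?_
    simp only [pathJacobian, Finset.prod_range_succ, stateOf, ← hc]
    ring

end Trajectory

/-! ### Entropies of finitely valued variables as expectations of log-masses. -/

section FiniteValued

variable {Ω : Type*} [MeasurableSpace Ω] {P : Measure Ω} [IsProbabilityMeasure P]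

/-- The probability mass of the value that the random variable `X` takes at `ω`. -/
noncomputable def massAt {S : Type*} (P : Measure Ω) (X : Ω → S) (ω : Ω) : ℝ :=
  P.real (X ⁻¹' {X ω})

lemma ae_massAt_ne_zero {S : Type*} [Finite S] (X : Ω → S) : ∀ᵐ ω ∂P, massAt P X ω ≠ 0 := by
  have h : ∀ s, ∀ᵐ ω ∂P, X ω = s → P.real (X ⁻¹' {s}) ≠ 0 := by
    intro s
    by_cases hs : P.real (X ⁻¹' {s}) = 0
    · rw [measureReal_eq_zero_iff] at hs
      filter_upwards [measure_eq_zero_iff_ae_notMem.1 hs] with ω hω h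
      exact absurd h hω
    · exact ae_of_all _ fun _ _ => hs
  filter_upwards [ae_all_iff.2 h] with ω hω
  exact hω _ rfl

variable {S : Type*} [Fintype S] [MeasurableSpace S] [MeasurableSingletonClass S]
  {S' : Type*} [Fintype S'] [MeasurableSpace S'] [MeasurableSingletonClass S']
  {U : Type*} [Fintype U] [MeasurableSpace U] [MeasurableSingletonClass U]

lemma integrable_comp_of_fintype {X : Ω → S} (hX : Measurable X) (φ : S → ℝ) :
    Integrable (fun ω => φ (X ω)) P :=
  have : IsProbabilityMeasure (P.map X) := Measure.isProbabilityMeasure_map hX.aemeasurable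
  (Integrable.of_finite (μ := P.map X) (f := φ)).comp_measurable hX

lemma integral_comp_of_fintype {X : Ω → S} (hX : Measurable X) (φ : S → ℝ) :
    ∫ ω, φ (X ω) ∂P = ∑ s, P.real (X ⁻¹' {s}) * φ s := by
  have : IsProbabilityMeasure (P.map X) := Measure.isProbabilityMeasure_map hX.aemeasurable
  rw [← integral_map hX.aemeasurable (Measurable.of_discrete).aestronglyMeasurable,
    integral_fintype Integrable.of_finite]
  refine Finset.sum_congr rfl fun s _ => ?_
  rw [map_measureReal_apply hX (measurableSet_singleton s), smul_eq_mul]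

lemma integrable_log_massAt {X : Ω → S} (hX : Measurable X) :
    Integrable (fun ω => Real.log (massAt P X ω)) P :=
  integrable_comp_of_fintype hX fun s => Real.log (P.real (X ⁻¹' {s}))

lemma condEntropy_eq_integral {X : Ω → S} {Z : Ω → U} (hX : Measurable X) (hZ : Measurable Z) :
    condEntropy P X Z = ∫ ω, (Real.log (massAt P Z ω) -
      Real.log (massAt P (fun ω => (X ω, Z ω)) ω)) / Real.log 2 ∂P := by
  have h := integral_comp_of_fintype (P := P) (hX.prodMk hZ) fun a =>
    (Real.log (P.real (Z ⁻¹' {a.2})) -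
      Real.log (P.real ((fun ω => (X ω, Z ω)) ⁻¹' {a}))) / Real.log 2
  refine Eq.trans ?_ h.symm
  rw [condEntropy, Fintype.sum_prod_type_right]
  refine Finset.sum_congr rfl fun u _ => ?_
  rw [entropy, Finset.mul_sum]
  refine Finset.sum_congr rfl fun a _ => ?_
  have hset : (fun ω => (X ω, Z ω)) ⁻¹' {(a, u)} = Z ⁻¹' {u} ∩ X ⁻¹' {a} := by
    ext ω; simp [and_comm]
  have hm : MeasurableSet (Z ⁻¹' {u}) := hZ (measurableSet_singleton u)
  rw [hset, measureReal_def (P[|Z ⁻¹' {u}]), cond_apply hm, ENNReal.toReal_mul,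
    ENNReal.toReal_inv, ← measureReal_def, ← measureReal_def]
  -- Both null cases read `0 = 0`, whatever the values given to conditioning on a null event and to
  -- `log 0`.
  rcases eq_or_ne (P.real (Z ⁻¹' {u})) 0 with h0 | h0
  · have : P.real (Z ⁻¹' {u} ∩ X ⁻¹' {a}) = 0 :=
      le_antisymm (h0 ▸ measureReal_mono Set.inter_subset_left) measureReal_nonneg
    simp [h0, this]
  rcases eq_or_ne (P.real (Z ⁻¹' {u} ∩ X ⁻¹' {a})) 0 with h1 | h1
  · simp [h1]
  rw [Real.negMulLog, Real.log_mul (inv_ne_zero h0) h1, Real.log_inv]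
  field_simp
  ring

/-- Here `c` plays the role of the conditional probability of `Y` given `(X, Z)`. Factoring the
joint mass through it cancels the mass of `(X, Z)`, leaving the expectation of log (`c` / P(Y | Z)).
-/
lemma condMutualInfo_eq_integral {X : Ω → S} {Y : Ω → S'} {Z : Ω → U} (hX : Measurable X)
    (hY : Measurable Y) (hZ : Measurable Z) (c : S → U → S' → ℝ)
    (hc : ∀ a u b, P.real {ω | X ω = a ∧ Z ω = u ∧ Y ω = b} =
      c a u b * P.real {ω | X ω = a ∧ Z ω = u}) :
    condMutualInfo P X Y Z = ∫ ω, (Real.log (c (X ω) (Z ω) (Y ω)) + Real.log (massAt P Z ω) -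
      Real.log (massAt P (fun ω => (Y ω, Z ω)) ω)) / Real.log 2 ∂P := by
  have hYZ := hY.prodMk hZ
  rw [condMutualInfo, condEntropy_eq_integral hX hZ, condEntropy_eq_integral hX hYZ,
    ← integral_sub]
  · refine integral_congr_ae ?_
    filter_upwards [ae_massAt_ne_zero (P := P) fun ω => (X ω, (Y ω, Z ω))] with ω hω
    have h : massAt P (fun ω => (X ω, (Y ω, Z ω))) ω =
        c (X ω) (Z ω) (Y ω) * massAt P (fun ω => (X ω, Z ω)) ω := by
      have h₁ : (fun ω => (X ω, (Y ω, Z ω))) ⁻¹' {(X ω, (Y ω, Z ω))} =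
          {ω' | X ω' = X ω ∧ Z ω' = Z ω ∧ Y ω' = Y ω} := by
        ext ω'; simp; tauto
      have h₂ : (fun ω => (X ω, Z ω)) ⁻¹' {(X ω, Z ω)} = {ω' | X ω' = X ω ∧ Z ω' = Z ω} := by
        ext ω'; simp
      rw [massAt, massAt, h₁, h₂, hc]
    rw [h] at hω
    rw [h, Real.log_mul (left_ne_zero_of_mul hω) (right_ne_zero_of_mul hω)]
    ring
  · exact ((integrable_log_massAt hZ).sub (integrable_log_massAt (hX.prodMk hZ))).div_const _
  · exact ((integrable_log_massAt hYZ).sub (integrable_log_massAt (hX.prodMk hYZ))).div_const _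

end FiniteValued

/-! ### The closed loop: the law of the outputs given the initial state and the noise. -/

section ClosedLoop

variable {N d s : ℕ} {M M' : Type*} [Fintype M] [MeasurableSpace M] [MeasurableSingletonClass M]
  [Fintype M'] [MeasurableSpace M'] [MeasurableSingletonClass M']
  {Ω : Type*} [MeasurableSpace Ω] {P : Measure Ω} [IsProbabilityMeasure P]
  {f : Vec N → Vec d → Vec N} {B : Matrix (Fin N) (Fin s) ℝ} {ν : Measure (Vec d)}
  {ch : Channel M M'} {γe : CodingPolicy N M M'} {γ : ControlPolicy s M'}
  {x : ℕ → Ω → Vec N} {w : ℕ → Ω → Vec d} {q : ℕ → Ω → M} {q' : ℕ → Ω → M'}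

/-- The initial state together with the noise sequence. -/
def source (x : ℕ → Ω → Vec N) (w : ℕ → Ω → Vec d) (ω : Ω) : Vec N × (ℕ → Vec d) :=
  (x 0 ω, fun r => w r ω)

lemma measurable_history {S : Type*} [MeasurableSpace S] {a : ℕ → Ω → S}
    (ha : ∀ t, Measurable (a t)) (t : ℕ) : Measurable (history a t) :=
  measurable_pi_lambda _ fun i => ha i

namespace IsClosedLoop

lemma measurable_source (h : IsClosedLoop P f B ν ch γe γ x w q q') : Measurable (source x w) :=
  h.measurable_init.prodMk (measurable_pi_lambda _ h.measurable_noise)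

lemma state_eq_stateOf (h : IsClosedLoop P f B ν ch γe γ x w q q') (t : ℕ) (ω : Ω) :
    x t ω = stateOf f B γ (fun i => q' i ω) (source x w ω) t := by
  induction t with
  | zero => rfl
  | succ t ih => rw [h.state_eq, ih]; rfl

lemma input_eq_inputOf (h : IsClosedLoop P f B ν ch γe γ x w q q') (t : ℕ) (ω : Ω) :
    q t ω = inputOf f B γe γ (fun i => q' i ω) (source x w ω) t := by
  have hx : history x (t + 1) ω =
      fun i : Fin (t + 1) => stateOf f B γ (fun i => q' i ω) (source x w ω) i :=
    funext fun i => h.state_eq_stateOf i ω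
  rw [h.input_eq, hx]; rfl

lemma measurable_state (h : IsClosedLoop P f B ν ch γe γ x w q q')
    (hf : Measurable (Function.uncurry f)) (t : ℕ) : Measurable (x t) := by
  induction t with
  | zero => exact h.measurable_init
  | succ t ih =>
    have hγ : Measurable fun ω => Matrix.toEuclideanLin B (γ t (history q' (t + 1) ω)) :=
      (Measurable.of_discrete (f := fun a => Matrix.toEuclideanLin B (γ t a))).comp
        (measurable_history h.measurable_output _)
    have hfx : Measurable fun ω => f (x t ω) (w t ω) := hf.comp (ih.prodMk (h.measurable_noise t))
    rw [funext (h.state_eq t)]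
    exact hfx.add hγ

lemma measurable_input (h : IsClosedLoop P f B ν ch γe γ x w q q')
    (hf : Measurable (Function.uncurry f)) (hγe : ∀ t, Measurable (Function.uncurry (γe t)))
    (t : ℕ) : Measurable (q t) := by
  rw [funext (h.input_eq t)]
  exact (hγe t).comp ((measurable_history (h.measurable_state hf) _).prodMk
    (measurable_history h.measurable_output _))

/-- The channel axiom freed of conditional expectations. Integrated over the events of the
conditioning σ-algebra, it says that two measures have the same push-forward under the conditioning
variable, so any nonnegative measurable `G` may be integrated, without integrability. -/
lemma setLIntegral_output (h : IsClosedLoop P f B ν ch γe γ x w q q')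
    (hf : Measurable (Function.uncurry f)) (hγe : ∀ t, Measurable (Function.uncurry (γe t)))
    (t : ℕ) (b : M')
    {G : (Vec N × (ℕ → Vec d)) × ((Fin (t + 1) → M) × (Fin t → M')) → ENNReal}
    (hG : Measurable G) :
    ∫⁻ ω in q' t ⁻¹' {b}, G (source x w ω, (history q (t + 1) ω, history q' t ω)) ∂P =
      ∫⁻ ω, ch t (history q (t + 1) ω) (history q' t ω) b *
        G (source x w ω, (history q (t + 1) ω, history q' t ω)) ∂P := by
  set Z : Ω → (Vec N × (ℕ → Vec d)) × ((Fin (t + 1) → M) × (Fin t → M')) :=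
    fun ω => (source x w ω, (history q (t + 1) ω, history q' t ω))
  set c : Ω → ENNReal := fun ω => ch t (history q (t + 1) ω) (history q' t ω) b
  have hpair : Measurable fun ω => (history q (t + 1) ω, history q' t ω) :=
    (measurable_history (h.measurable_input hf hγe) _).prodMk
      (measurable_history h.measurable_output _)
  have hZ : Measurable Z := h.measurable_source.prodMk hpair
  have hc : Measurable c :=
    (Measurable.of_discrete
      (f := fun a : (Fin (t + 1) → M) × (Fin t → M') => ch t a.1 a.2 b)).comp hpair
  have hc1 : ∀ ω, c ω ≤ 1 := fun ω => PMF.coe_le_one _ _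
  have hE : MeasurableSet (q' t ⁻¹' {b}) := h.measurable_output t (measurableSet_singleton b)
  have hmeas : (P.restrict (q' t ⁻¹' {b})).map Z = (P.withDensity c).map Z := by
    ext S hS
    have hZS : MeasurableSet (Z ⁻¹' S) := hZ hS
    rw [Measure.map_apply hZ hS, Measure.map_apply hZ hS, Measure.restrict_apply hZS,
      withDensity_apply _ hZS]
    have hfin : ∫⁻ ω in Z ⁻¹' S, c ω ∂P ≠ ⊤ := by
      refine ne_top_of_le_ne_top (measure_ne_top P (Z ⁻¹' S)) ?_
      calc ∫⁻ ω in Z ⁻¹' S, c ω ∂P ≤ ∫⁻ _ in Z ⁻¹' S, 1 ∂P := lintegral_mono fun ω => hc1 ω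
        _ = P (Z ⁻¹' S) := by simp
    have h₁ := setIntegral_condExp (μ := P) hZ.comap_le
      (f := (q' t ⁻¹' {b}).indicator fun _ => (1 : ℝ)) (s := Z ⁻¹' S)
      ((integrable_const (1 : ℝ)).indicator hE) ⟨S, hS, rfl⟩
    have h₂ : ∫ ω in Z ⁻¹' S, (P[(q' t ⁻¹' {b}).indicator (fun _ => (1 : ℝ)) |
        MeasurableSpace.comap Z inferInstance]) ω ∂P = ∫ ω in Z ⁻¹' S, (c ω).toReal ∂P :=
      setIntegral_congr_ae hZS ((h.output_law t b).mono fun ω hω _ => hω)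
    rw [h₂, integral_toReal hc.aemeasurable
      (ae_of_all _ fun ω => (hc1 ω).trans_lt ENNReal.one_lt_top),
      setIntegral_indicator hE, setIntegral_const, smul_eq_mul, mul_one, measureReal_def] at h₁
    exact ((ENNReal.toReal_eq_toReal_iff' hfin (measure_ne_top _ _)).1 h₁).symm
  calc ∫⁻ ω in q' t ⁻¹' {b}, G (Z ω) ∂P
      = ∫⁻ a, G a ∂((P.restrict (q' t ⁻¹' {b})).map Z) := (lintegral_map hG hZ).symm
    _ = ∫⁻ ω, G (Z ω) ∂(P.withDensity c) := by rw [hmeas, lintegral_map hG hZ]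
    _ = ∫⁻ ω, c ω * G (Z ω) ∂P := by
      exact lintegral_withDensity_eq_lintegral_mul P hc (hG.comp hZ)

lemma measurableSet_outputs (h : IsClosedLoop P f B ν ch γe γ x w q q') (b : ℕ → M') (t : ℕ) :
    MeasurableSet {ω | ∀ i < t, q' i ω = b i} := by
  simp only [Set.ofPred_forall]
  exact MeasurableSet.iInter fun i => MeasurableSet.iInter fun _ =>
    h.measurable_output i (measurableSet_singleton (b i))

/-- Where the earlier outputs equal `b`, the inputs are determined by the source. The channel factor
at time `t` is then a function of the source alone and can be passed to the induction hypothesis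
together with `F`. -/
lemma setLIntegral_outputs (h : IsClosedLoop P f B ν ch γe γ x w q q')
    (hf : Measurable (Function.uncurry f)) (hγe : ∀ t, Measurable (Function.uncurry (γe t)))
    (b : ℕ → M') (t : ℕ) {F : Vec N × (ℕ → Vec d) → ENNReal} (hF : Measurable F) :
    ∫⁻ ω in {ω | ∀ i < t, q' i ω = b i}, F (source x w ω) ∂P =
      ∫⁻ ω, pathProb f B ch γe γ b (source x w ω) t * F (source x w ω) ∂P := by
  induction t generalizing F with
  | zero => simp [pathProb]
  | succ t ih =>
    set E := {ω | ∀ i < t, q' i ω = b i} with hEdef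
    have hE : MeasurableSet E := h.measurableSet_outputs b t
    have hEh : ∀ ω, ω ∈ E ↔ history q' t ω = fun i : Fin t => b i := fun ω =>
      ⟨fun hω => funext fun i => hω i i.2, fun hω i hi => congrFun hω ⟨i, hi⟩⟩
    have hset : {ω | ∀ i < t + 1, q' i ω = b i} = E ∩ q' t ⁻¹' {b t} := by
      ext ω
      simp only [Set.mem_ofPred_eq, Set.mem_inter_iff, Set.mem_preimage, Set.mem_singleton_iff,
        hEdef, Order.lt_add_one_iff]
      exact ⟨fun hω => ⟨fun i hi => hω i hi.le, hω t le_rfl⟩,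
        fun hω i hi => hi.lt_or_eq.elim (hω.1 i) fun hi => hi ▸ hω.2⟩
    have hD : MeasurableSet {a : (Vec N × (ℕ → Vec d)) × ((Fin (t + 1) → M) × (Fin t → M')) |
        a.2.2 = fun i : Fin t => b i} :=
      (measurable_snd.comp measurable_snd) (measurableSet_singleton fun i : Fin t => b i)
    have hG := (hF.comp measurable_fst).indicator hD
    have hout := h.setLIntegral_output hf hγe t (b t) hG
    have hch : ∀ ω ∈ E, ch t (history q (t + 1) ω) (history q' t ω) (b t) =
        ch t (fun i => inputOf f B γe γ b (source x w ω) i) (fun i => b i) (b t) := by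
      intro ω hω
      have hq : history q (t + 1) ω =
          fun i : Fin (t + 1) => inputOf f B γe γ b (source x w ω) i :=
        funext fun i => (h.input_eq_inputOf i ω).trans
          (inputOf_congr rfl (fun _ _ => rfl) fun j hj => hω j (by lia))
      rw [hq, (hEh ω).1 hω]
    have hcm : Measurable fun z : Vec N × (ℕ → Vec d) =>
        ch t (fun i => inputOf f B γe γ b z i) (fun i => b i) (b t) :=
      (Measurable.of_discrete
        (f := fun a : Fin (t + 1) → M => ch t a (fun i => b i) (b t))).comp
        (measurable_pi_lambda _ fun i : Fin (t + 1) => measurable_inputOf hf hγe b i)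
    calc ∫⁻ ω in {ω | ∀ i < t + 1, q' i ω = b i}, F (source x w ω) ∂P
        = ∫⁻ ω in q' t ⁻¹' {b t}, E.indicator (fun ω => F (source x w ω)) ω ∂P := by
          rw [hset, ← Measure.restrict_restrict hE, lintegral_indicator hE]
      _ = ∫⁻ ω in q' t ⁻¹' {b t}, Set.indicator {a : (Vec N × (ℕ → Vec d)) ×
            ((Fin (t + 1) → M) × (Fin t → M')) | a.2.2 = fun i : Fin t => b i} (F ∘ Prod.fst)
            (source x w ω, (history q (t + 1) ω, history q' t ω)) ∂P := by
          refine lintegral_congr fun ω => ?_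
          by_cases hω : ω ∈ E
          · rw [Set.indicator_of_mem hω, Set.indicator_of_mem (by exact (hEh ω).1 hω)]; rfl
          · rw [Set.indicator_of_notMem hω,
              Set.indicator_of_notMem (by exact fun h => hω ((hEh ω).2 h))]
      _ = ∫⁻ ω in E, ch t (fun i => inputOf f B γe γ b (source x w ω) i) (fun i => b i) (b t) *
            F (source x w ω) ∂P := by
          rw [hout, ← lintegral_indicator hE]
          refine lintegral_congr fun ω => ?_
          by_cases hω : ω ∈ E
          · rw [Set.indicator_of_mem hω, Set.indicator_of_mem (by exact (hEh ω).1 hω), hch ω hω]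
            rfl
          · rw [Set.indicator_of_notMem hω,
              Set.indicator_of_notMem (by exact fun h => hω ((hEh ω).2 h)), mul_zero]
      _ = _ := by
          refine (ih (hcm.mul hF)).trans ?_
          refine lintegral_congr fun ω => ?_
          rw [pathProb, pathProb, Finset.prod_range_succ, mul_assoc]; rfl

lemma real_output (h : IsClosedLoop P f B ν ch γe γ x w q q')
    (hf : Measurable (Function.uncurry f)) (hγe : ∀ t, Measurable (Function.uncurry (γe t)))
    (t : ℕ) (a : Fin (t + 1) → M) (u : Fin t → M') (b : M') :
    P.real {ω | history q (t + 1) ω = a ∧ history q' t ω = u ∧ q' t ω = b} =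
      (ch t a u b).toReal * P.real {ω | history q (t + 1) ω = a ∧ history q' t ω = u} := by
  have hD : MeasurableSet {e : (Vec N × (ℕ → Vec d)) × ((Fin (t + 1) → M) × (Fin t → M')) |
      e.2 = (a, u)} := measurable_snd (measurableSet_singleton (a, u))
  have hpair : Measurable fun ω => (history q (t + 1) ω, history q' t ω) :=
    (measurable_history (h.measurable_input hf hγe) _).prodMk
      (measurable_history h.measurable_output _)
  set E := {ω | history q (t + 1) ω = a ∧ history q' t ω = u} with hEdef
  have hE' : E = (fun ω => (history q (t + 1) ω, history q' t ω)) ⁻¹' {(a, u)} := by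
    ext ω; simp [hEdef]
  have hE : MeasurableSet E := hE' ▸ hpair (measurableSet_singleton _)
  have hind : ∀ ω, Set.indicator {e : (Vec N × (ℕ → Vec d)) ×
      ((Fin (t + 1) → M) × (Fin t → M')) | e.2 = (a, u)} (fun _ => (1 : ENNReal))
      (source x w ω, (history q (t + 1) ω, history q' t ω)) = E.indicator 1 ω := by
    intro ω
    by_cases hω : ω ∈ E
    · rw [Set.indicator_of_mem hω, Set.indicator_of_mem (by exact Prod.ext hω.1 hω.2)]; rfl
    · rw [Set.indicator_of_notMem hω, Set.indicator_of_notMem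
        (by exact fun h => hω ⟨congrArg Prod.fst h, congrArg Prod.snd h⟩)]
  have hset : {ω | history q (t + 1) ω = a ∧ history q' t ω = u ∧ q' t ω = b} =
      E ∩ q' t ⁻¹' {b} := by
    ext ω; simp [hEdef, and_assoc]
  have hout := h.setLIntegral_output hf hγe t b (measurable_const (a := (1 : ENNReal)).indicator hD)
  simp only [hind] at hout
  rw [lintegral_indicator_one hE, Measure.restrict_apply hE] at hout
  have : ∀ ω, ch t (history q (t + 1) ω) (history q' t ω) b * E.indicator 1 ω =
      E.indicator (fun _ => ch t a u b) ω := by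
    intro ω
    by_cases hω : ω ∈ E
    · simp only [Set.indicator_of_mem hω, Pi.one_apply, mul_one, hω.1, hω.2]
    · simp [Set.indicator_of_notMem hω]
  simp only [this] at hout
  rw [lintegral_indicator_const hE] at hout
  rw [hset, measureReal_def, hout, ENNReal.toReal_mul, ← measureReal_def]

end IsClosedLoop

end ClosedLoop

/-! ### Summing over output words; independence of state and noise; the ratio bound. -/

section ClosedLoop

variable {N d s : ℕ} {M M' : Type*} [Fintype M] [MeasurableSpace M] [MeasurableSingletonClass M]
  [Fintype M'] [MeasurableSpace M'] [MeasurableSingletonClass M']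
  {Ω : Type*} [MeasurableSpace Ω] {P : Measure Ω} [IsProbabilityMeasure P]
  {f : Vec N → Vec d → Vec N} {B : Matrix (Fin N) (Fin s) ℝ} {ν : Measure (Vec d)}
  {ch : Channel M M'} {γe : CodingPolicy N M M'} {γ : ControlPolicy s M'}
  {x : ℕ → Ω → Vec N} {w : ℕ → Ω → Vec d} {q : ℕ → Ω → M} {q' : ℕ → Ω → M'}

/-- An infinite sequence whose first terms are those of a given tuple. -/
noncomputable def extendSeq {S : Type*} [Nonempty S] {T : ℕ} (b : Fin T → S) (i : ℕ) : S :=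
  if h : i < T then b ⟨i, h⟩ else Classical.arbitrary S

lemma extendSeq_of_lt {S : Type*} [Nonempty S] {T : ℕ} (b : Fin T → S) {i : ℕ} (h : i < T) :
    extendSeq b i = b ⟨i, h⟩ := dif_pos h

lemma sum_setLIntegral_preimage_singleton {S : Type*} [Fintype S] [MeasurableSpace S]
    [MeasurableSingletonClass S] {X : Ω → S} (hX : Measurable X) (H : Ω → ENNReal) :
    ∑ b, ∫⁻ ω in X ⁻¹' {b}, H ω ∂P = ∫⁻ ω, H ω ∂P := by
  have h := lintegral_iUnion (μ := P) (s := fun b => X ⁻¹' {b})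
    (fun b => hX (measurableSet_singleton b))
    (fun b c hbc => Disjoint.preimage _ (Set.disjoint_singleton.2 hbc)) H
  rw [tsum_fintype, ← Set.preimage_iUnion, Set.iUnion_of_singleton, Set.preimage_univ,
    Measure.restrict_univ] at h
  exact h.symm

namespace IsClosedLoop

lemma outputs_eq_preimage [Nonempty M'] {T : ℕ} (b : Fin T → M') :
    {ω | ∀ i < T, q' i ω = extendSeq b i} = history q' T ⁻¹' {b} := by
  ext ω
  simp only [Set.mem_ofPred_eq, Set.mem_preimage, Set.mem_singleton_iff]
  constructor
  · exact fun h => funext fun i => (h i i.2).trans (extendSeq_of_lt b i.2)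
  · rintro rfl i hi
    rw [extendSeq_of_lt _ hi]; rfl

lemma measurable_comp_outputs (h : IsClosedLoop P f B ν ch γe γ x w q q') (T : ℕ)
    {H : (ℕ → M') → Vec N × (ℕ → Vec d) → ENNReal} (hH : ∀ b, Measurable (H b))
    (hloc : ∀ b b' z, (∀ i < T, b i = b' i) → H b z = H b' z) :
    Measurable fun ω => H (fun i => q' i ω) (source x w ω) := by
  rcases isEmpty_or_nonempty Ω with hΩ | ⟨⟨ω₀⟩⟩
  · exact measurable_of_empty _
  have : Nonempty M' := ⟨q' 0 ω₀⟩
  have h₁ : Measurable fun a : (Fin T → M') × (Vec N × (ℕ → Vec d)) => H (extendSeq a.1) a.2 :=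
    measurable_from_prod_countable_right fun b => hH (extendSeq b)
  have h₂ := h₁.comp ((measurable_history h.measurable_output T).prodMk h.measurable_source)
  convert h₂ using 2 with ω
  exact hloc _ _ _ fun i hi => (extendSeq_of_lt (history q' T ω) hi).symm

/-- Replaces the random outputs by deterministic words weighted by their conditional probability,
after which every integrand depends on the source only. -/
lemma lintegral_outputs [Nonempty M'] (h : IsClosedLoop P f B ν ch γe γ x w q q')
    (hf : Measurable (Function.uncurry f)) (hγe : ∀ t, Measurable (Function.uncurry (γe t)))
    (T : ℕ) {H : (ℕ → M') → Vec N × (ℕ → Vec d) → ENNReal} (hH : ∀ b, Measurable (H b))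
    (hloc : ∀ b b' z, (∀ i < T, b i = b' i) → H b z = H b' z) :
    ∫⁻ ω, H (fun i => q' i ω) (source x w ω) ∂P =
      ∑ b : Fin T → M', ∫⁻ ω, pathProb f B ch γe γ (extendSeq b) (source x w ω) T *
        H (extendSeq b) (source x w ω) ∂P := by
  rw [← sum_setLIntegral_preimage_singleton (measurable_history h.measurable_output T)]
  refine Finset.sum_congr rfl fun b _ => ?_
  rw [← h.setLIntegral_outputs hf hγe _ T (hH _), ← outputs_eq_preimage]
  refine setLIntegral_congr_fun (h.measurableSet_outputs _ T) fun ω hω => ?_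
  exact hloc _ _ _ hω

lemma ae_pathProb_ne_zero (h : IsClosedLoop P f B ν ch γe γ x w q q')
    (hf : Measurable (Function.uncurry f)) (hγe : ∀ t, Measurable (Function.uncurry (γe t)))
    (T : ℕ) :
    ∀ᵐ ω ∂P, pathProb f B ch γe γ (fun i => q' i ω) (source x w ω) T ≠ 0 := by
  obtain ⟨ω₀⟩ : Nonempty Ω := P.nonempty_of_neZero
  have : Nonempty M' := ⟨q' 0 ω₀⟩
  have hset : ∀ b, MeasurableSet {z | pathProb f B ch γe γ b z T = 0} := fun b =>
    measurable_pathProb hf hγe b T (measurableSet_singleton 0)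
  -- The indicator of zero path probability is tested against the path probability itself, so every
  -- term of the sum vanishes.
  have hH : ∀ b, Measurable fun z =>
      Set.indicator {z | pathProb f B ch γe γ b z T = 0} (fun _ => (1 : ENNReal)) z :=
    fun b => measurable_const.indicator (hset b)
  have hloc : ∀ (b b' : ℕ → M') (z : Vec N × (ℕ → Vec d)), (∀ i < T, b i = b' i) →
      Set.indicator {z | pathProb f B ch γe γ b z T = 0} (fun _ => (1 : ENNReal)) z =
      Set.indicator {z | pathProb f B ch γe γ b' z T = 0} (fun _ => (1 : ENNReal)) z := by
    intro b b' z hb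
    have := pathProb_congr (f := f) (B := B) (ch := ch) (γe := γe) (γ := γ) (z := z) rfl
      (fun _ _ => rfl) hb
    simp only [Set.indicator_apply, Set.mem_ofPred_eq, this]
  have hzero := h.lintegral_outputs hf hγe T hH hloc
  rw [Finset.sum_eq_zero, lintegral_eq_zero_iff (h.measurable_comp_outputs T hH hloc)] at hzero
  · filter_upwards [hzero] with ω hω h0
    rw [Set.indicator_of_mem (by exact h0)] at hω
    exact one_ne_zero hω
  · intro b _
    refine (lintegral_congr fun ω => ?_).trans lintegral_zero
    by_cases h0 : pathProb f B ch γe γ (extendSeq b) (source x w ω) T = 0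
    · rw [h0, zero_mul]
    · rw [Set.indicator_of_notMem (by exact h0), mul_zero]

lemma map_source (h : IsClosedLoop P f B ν ch γe γ x w q q') :
    P.map (source x w) = (P.map (x 0)).prod (P.map fun ω t => w t ω) :=
  (indepFun_iff_map_prod_eq_prod_map_map h.measurable_init.aemeasurable
    (measurable_pi_lambda _ h.measurable_noise).aemeasurable).1 h.init_indep

/-- Independence of `w t` from the initial state and the earlier noise: Fubini freezes the initial
state, and i.i.d. noise gives the product formula for what remains. -/
lemma lintegral_mul_noise (h : IsClosedLoop P f B ν ch γe γ x w q q') (t : ℕ)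
    {φ : Vec N × (ℕ → Vec d) → ENNReal} (hφ : Measurable φ)
    (hloc : ∀ y v v', (∀ i < t, v i = v' i) → φ (y, v) = φ (y, v'))
    {ψ : Vec d → ENNReal} (hψ : Measurable ψ) :
    ∫⁻ ω, φ (source x w ω) * ψ (w t ω) ∂P = (∫⁻ ω, φ (source x w ω) ∂P) * ∫⁻ v, ψ v ∂ν := by
  have hw : Measurable fun ω t => w t ω := measurable_pi_lambda _ h.measurable_noise
  have hpr : IsProbabilityMeasure (P.map fun ω t => w t ω) :=
    Measure.isProbabilityMeasure_map hw.aemeasurable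
  have hψt : Measurable fun v : ℕ → Vec d => ψ (v t) := hψ.comp (measurable_pi_apply t)
  have hφψ : Measurable fun z : Vec N × (ℕ → Vec d) => φ z * ψ (z.2 t) :=
    hφ.mul (hψt.comp measurable_snd)
  have h₁ : ∫⁻ ω, φ (source x w ω) * ψ (w t ω) ∂P =
      ∫⁻ y, ∫⁻ v, φ (y, v) * ψ (v t) ∂(P.map fun ω t => w t ω) ∂(P.map (x 0)) := by
    rw [← lintegral_prod (fun z : Vec N × (ℕ → Vec d) => φ z * ψ (z.2 t)) hφψ.aemeasurable,
      ← h.map_source, lintegral_map hφψ h.measurable_source]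
    rfl
  have h₂ : ∫⁻ ω, φ (source x w ω) ∂P =
      ∫⁻ y, ∫⁻ v, φ (y, v) ∂(P.map fun ω t => w t ω) ∂(P.map (x 0)) := by
    rw [← lintegral_prod _ hφ.aemeasurable, ← h.map_source, lintegral_map hφ h.measurable_source]
  rw [h₁, h₂, ← lintegral_mul_const _ hφ.lintegral_prod_right']
  refine lintegral_congr fun y => ?_
  have hφy : Measurable fun v : ℕ → Vec d => φ (y, v) := hφ.comp measurable_prodMk_left
  have hφψy : Measurable fun v : ℕ → Vec d => φ (y, v) * ψ (v t) := hφy.mul hψt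
  rw [lintegral_map hφψy hw, lintegral_map hφy hw, ← h.noise_law t,
    lintegral_map hψ (h.measurable_noise t)]
  have hind := h.noise_indep.indepFun_finset (Finset.range t) {t} (by simp) h.measurable_noise
  -- Padding the past noise by zeros exhibits `φ (y, ·)` as a function of the first `t` coordinates
  -- only.
  set e : ((i : Finset.range t) → Vec d) → ℕ → Vec d :=
    fun a i => if hi : i ∈ Finset.range t then a ⟨i, hi⟩ else 0 with he
  have hem : Measurable e := by
    refine measurable_pi_lambda _ fun i => ?_
    by_cases hi : i ∈ Finset.range t
    · simpa only [he, dif_pos hi] using measurable_pi_apply _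
    · simp only [he, dif_neg hi, measurable_const]
  have hind' := hind.comp (hφy.comp hem)
    (hψ.comp (measurable_pi_apply (⟨t, Finset.mem_singleton_self t⟩ : ({t} : Finset ℕ))))
  have heq : ∀ ω, φ (y, fun t => w t ω) = φ (y, e fun i => w i ω) := fun ω =>
    hloc _ _ _ fun i hi => by simp only [he, dif_pos (Finset.mem_range.2 hi)]
  simp only [heq]
  exact lintegral_mul_eq_lintegral_mul_lintegral_of_indepFun
    ((hφy.comp hem).comp (measurable_pi_lambda _ fun i => h.measurable_noise i))
    (hψ.comp (h.measurable_noise t)) hind'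

/-- The state also depends on the channel's randomness through feedback. For each output word,
however, both the path probability and the state involve only the initial state and the noise before
`t`, so `w t` splits off term by term. -/
lemma map_state_noise (h : IsClosedLoop P f B ν ch γe γ x w q q')
    (hf : Measurable (Function.uncurry f)) (hγe : ∀ t, Measurable (Function.uncurry (γe t)))
    (t : ℕ) : P.map (fun ω => (x t ω, w t ω)) = (P.map (x t)).prod ν := by
  obtain ⟨ω₀⟩ : Nonempty Ω := P.nonempty_of_neZero
  have : Nonempty M' := ⟨q' 0 ω₀⟩
  have hx := h.measurable_state hf t
  have hw := h.measurable_noise t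
  have : IsProbabilityMeasure (P.map (x t)) := Measure.isProbabilityMeasure_map hx.aemeasurable
  have : IsProbabilityMeasure ν :=
    h.noise_law t ▸ Measure.isProbabilityMeasure_map hw.aemeasurable
  refine (Measure.prod_eq fun A C hA hC => ?_).symm
  have hst : ∀ b : ℕ → M', Measurable fun z : Vec N × (ℕ → Vec d) =>
      A.indicator (1 : Vec N → ENNReal) (stateOf f B γ b z t) := fun b =>
    (measurable_one.indicator hA).comp (measurable_stateOf hf b t)
  have hC1 : Measurable (C.indicator (1 : Vec d → ENNReal)) := measurable_one.indicator hC
  have hloc : ∀ (b b' : ℕ → M') (z : Vec N × (ℕ → Vec d)), (∀ i < t, b i = b' i) →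
      A.indicator (1 : Vec N → ENNReal) (stateOf f B γ b z t) =
        A.indicator (1 : Vec N → ENNReal) (stateOf f B γ b' z t) := fun b b' z hb => by
    rw [stateOf_congr rfl (fun _ _ => rfl) hb]
  have hA' : P.map (x t) A =
      ∫⁻ ω, A.indicator 1 (stateOf f B γ (fun i => q' i ω) (source x w ω) t) ∂P := by
    rw [← lintegral_indicator_one hA, lintegral_map (measurable_one.indicator hA) hx]
    simp only [h.state_eq_stateOf t]
  have hAC : P.map (fun ω => (x t ω, w t ω)) (A ×ˢ C) =
      ∫⁻ ω, A.indicator 1 (stateOf f B γ (fun i => q' i ω) (source x w ω) t) *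
        C.indicator 1 ((source x w ω).2 t) ∂P := by
    rw [← lintegral_indicator_one (hA.prod hC),
      lintegral_map (measurable_one.indicator (hA.prod hC)) (hx.prodMk hw)]
    refine lintegral_congr fun ω => ?_
    rw [← h.state_eq_stateOf t, ← Set.indicator_prod_one]
    rfl
  rw [hA', hAC, ← lintegral_indicator_one hC, h.lintegral_outputs hf hγe t hst hloc,
    h.lintegral_outputs hf hγe t
      (H := fun b z => A.indicator 1 (stateOf f B γ b z t) * C.indicator 1 (z.2 t))
      (fun b => (hst b).mul (hC1.comp ((measurable_pi_apply t).comp measurable_snd)))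
      (fun b b' z hb => by rw [hloc b b' z hb]), Finset.sum_mul]
  refine Finset.sum_congr rfl fun b _ => ?_
  refine Eq.trans (lintegral_congr fun ω => (mul_assoc _ _ _).symm)
    (h.lintegral_mul_noise t (φ := fun z => pathProb f B ch γe γ (extendSeq b) z t *
      A.indicator 1 (stateOf f B γ (extendSeq b) z t))
      ((measurable_pathProb hf hγe _ t).mul (hst _)) (fun y v v' hv => ?_) hC1)
  rw [pathProb_congr (z := (y, v)) (z' := (y, v')) rfl hv fun _ _ => rfl,
    stateOf_congr (z := (y, v)) (z' := (y, v')) rfl hv fun _ _ => rfl]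

/-- Dividing by the initial density turns the law of the initial state into at most Lebesgue
measure, to which the change of variables applies for each fixed noise. Equality can fail where the
density vanishes. -/
lemma lintegral_state_mul_jacobian_div_density_le
    (h : IsClosedLoop P f B ν ch γe γ x w q q') (hf : Measurable (Function.uncurry f))
    (hf_diff : ∀ v, ContDiff ℝ 1 fun y => f y v)
    (hf_inv : ∀ v, Function.Bijective fun y => f y v)
    (hx₀ : P.map (x 0) ≪ volume) (b : ℕ → M') (T : ℕ) {g : Vec N → ENNReal} (hg : Measurable g) :
    ∫⁻ ω, g (stateOf f B γ b (source x w ω) T) * pathJacobian f B γ b (source x w ω) T *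
      ((P.map (x 0)).rnDeriv volume (source x w ω).1)⁻¹ ∂P ≤ ∫⁻ y, g y := by
  set p := (P.map (x 0)).rnDeriv volume with hp
  have hw : Measurable fun ω t => w t ω := measurable_pi_lambda _ h.measurable_noise
  have hpr : IsProbabilityMeasure (P.map fun ω t => w t ω) :=
    Measure.isProbabilityMeasure_map hw.aemeasurable
  have hpm : Measurable p := Measure.measurable_rnDeriv _ _
  have hm₁ : Measurable fun z => g (stateOf f B γ b z T) * pathJacobian f B γ b z T :=
    (hg.comp (measurable_stateOf hf b T)).mul (measurable_pathJacobian hf hf_diff b T)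
  have hm : Measurable fun z => g (stateOf f B γ b z T) * pathJacobian f B γ b z T * (p z.1)⁻¹ :=
    hm₁.mul (hpm.comp measurable_fst).inv
  rw [← lintegral_map hm h.measurable_source, h.map_source,
    lintegral_prod_symm _ hm.aemeasurable]
  calc ∫⁻ v, ∫⁻ y, g (stateOf f B γ b (y, v) T) * pathJacobian f B γ b (y, v) T * (p y)⁻¹
        ∂(P.map (x 0)) ∂(P.map fun ω t => w t ω)
      ≤ ∫⁻ _ : ℕ → Vec d, (∫⁻ y, g y) ∂(P.map fun ω t => w t ω) := by
        refine lintegral_mono fun v => ?_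
        have hmv : Measurable fun y => g (stateOf f B γ b (y, v) T) *
            pathJacobian f B γ b (y, v) T * (p y)⁻¹ := hm.comp (measurable_prodMk_right (y := v))
        rw [← lintegral_rnDeriv_mul hx₀ hmv.aemeasurable,
          ← lintegral_stateOf_mul_pathJacobian hf_diff hf_inv b v T g]
        refine lintegral_mono fun y => ?_
        calc p y * (g (stateOf f B γ b (y, v) T) * pathJacobian f B γ b (y, v) T * (p y)⁻¹)
            = g (stateOf f B γ b (y, v) T) * pathJacobian f B γ b (y, v) T *
                (p y * (p y)⁻¹) := by ring
          _ ≤ _ := mul_le_of_le_one_right' (ENNReal.mul_inv_le_one _)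
    _ = ∫⁻ y, g y := by simp

/-- The ratio `|J| P(q'_{[0,T-1]}) / (p₀(x₀) P(q'_{[0,T-1]} | x₀, w))`, with `p₀` the density of
the initial state and `J` the Jacobian of the map from the initial state to the state at time
`T`. -/
noncomputable def ratio (P : Measure Ω) (f : Vec N → Vec d → Vec N) (B : Matrix (Fin N) (Fin s) ℝ)
    (ch : Channel M M') (γe : CodingPolicy N M M') (γ : ControlPolicy s M')
    (x : ℕ → Ω → Vec N) (q' : ℕ → Ω → M') (T : ℕ) (b : ℕ → M')
    (z : Vec N × (ℕ → Vec d)) : ENNReal :=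
  pathJacobian f B γ b z T * P {ω | ∀ i < T, q' i ω = b i} *
    ((P.map (x 0)).rnDeriv volume z.1)⁻¹ * (pathProb f B ch γe γ b z T)⁻¹

lemma measurable_ratio (hf : Measurable (Function.uncurry f))
    (hf_diff : ∀ v, ContDiff ℝ 1 fun y => f y v)
    (hγe : ∀ t, Measurable (Function.uncurry (γe t))) (T : ℕ) (b : ℕ → M') :
    Measurable (ratio P f B ch γe γ x q' T b) :=
  (((measurable_pathJacobian hf hf_diff b T).mul_const _).mul
    ((Measure.measurable_rnDeriv _ _).comp measurable_fst).inv).mul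
      (measurable_pathProb hf hγe b T).inv

lemma ratio_congr {T : ℕ} {b b' : ℕ → M'} (hb : ∀ i < T, b i = b' i)
    (z : Vec N × (ℕ → Vec d)) :
    ratio P f B ch γe γ x q' T b z = ratio P f B ch γe γ x q' T b' z := by
  have hset : {ω | ∀ i < T, q' i ω = b i} = {ω | ∀ i < T, q' i ω = b' i} := by
    ext ω
    exact forall₂_congr fun i hi => by rw [hb i hi]
  rw [ratio, ratio, pathJacobian_congr hb, pathProb_congr (z := z) rfl (fun _ _ => rfl) hb, hset]

/-- The path probability weighting each output word cancels against its inverse in `ratio`; the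
masses of the words remain and sum to 1. The lemma is used twice: with `g` the density of `x T`, and
with `g` the indicator of a null set. -/
lemma lintegral_state_mul_ratio_le
    (h : IsClosedLoop P f B ν ch γe γ x w q q') (hf : Measurable (Function.uncurry f))
    (hf_diff : ∀ v, ContDiff ℝ 1 fun y => f y v)
    (hf_inv : ∀ v, Function.Bijective fun y => f y v)
    (hγe : ∀ t, Measurable (Function.uncurry (γe t)))
    (hx₀ : P.map (x 0) ≪ volume) (T : ℕ) {g : Vec N → ENNReal} (hg : Measurable g) :
    ∫⁻ ω, g (x T ω) * ratio P f B ch γe γ x q' T (fun i => q' i ω) (source x w ω) ∂P ≤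
      ∫⁻ y, g y := by
  obtain ⟨ω₀⟩ : Nonempty Ω := P.nonempty_of_neZero
  have : Nonempty M' := ⟨q' 0 ω₀⟩
  simp only [h.state_eq_stateOf T]
  rw [h.lintegral_outputs hf hγe T
    (H := fun b z => g (stateOf f B γ b z T) * ratio P f B ch γe γ x q' T b z)
    (fun b => (hg.comp (measurable_stateOf hf b T)).mul (measurable_ratio hf hf_diff hγe T b))
    (fun b b' z hb => by rw [ratio_congr hb, stateOf_congr rfl (fun _ _ => rfl) hb])]
  calc _ ≤ ∑ b : Fin T → M', P (history q' T ⁻¹' {b}) * ∫⁻ y, g y := by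
        refine Finset.sum_le_sum fun b _ => ?_
        refine le_trans ?_ (mul_le_mul_right
          (h.lintegral_state_mul_jacobian_div_density_le hf hf_diff hf_inv hx₀ (extendSeq b) T hg)
          _)
        rw [← lintegral_const_mul' _ _ (measure_ne_top _ _)]
        refine lintegral_mono fun ω => ?_
        rw [ratio, outputs_eq_preimage]
        set K := pathProb f B ch γe γ (extendSeq b) (source x w ω) T
        set J := pathJacobian f B γ (extendSeq b) (source x w ω) T
        set D := (P.map (x 0)).rnDeriv volume (source x w ω).1
        set G := g (stateOf f B γ (extendSeq b) (source x w ω) T)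
        calc K * (G * (J * P (history q' T ⁻¹' {b}) * D⁻¹ * K⁻¹))
            = P (history q' T ⁻¹' {b}) * (G * J * D⁻¹) * (K * K⁻¹) := by ring
          _ ≤ _ := mul_le_of_le_one_right' (ENNReal.mul_inv_le_one _)
    _ = ∫⁻ y, g y := by
        have h1 := sum_setLIntegral_preimage_singleton (P := P)
          (measurable_history h.measurable_output T) fun _ => 1
        simp only [lintegral_one, Measure.restrict_apply_univ, measure_univ] at h1
        rw [← Finset.sum_mul, h1, one_mul]

end IsClosedLoop

end ClosedLoop

/-! ### Extended-real integrals with `⊤ - ⊤ = ⊥`. -/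

section ExtIntegral

variable {α : Type*} [MeasurableSpace α] {μ : Measure α}

lemma extIntegral_coe (g : α → ℝ) :
    extIntegral μ (fun a => (g a : EReal)) =
      ((∫⁻ a, ENNReal.ofReal (g a) ∂μ : ENNReal) : EReal) -
        ((∫⁻ a, ENNReal.ofReal (-g a) ∂μ : ENNReal) : EReal) := by
  simp only [extIntegral, ← EReal.coe_neg, EReal.toENNReal_of_ne_top (EReal.coe_ne_top _),
    EReal.toReal_coe]

lemma integrable_max_zero {g : α → ℝ} (hg : AEMeasurable g μ)
    (h : ∫⁻ a, ENNReal.ofReal (g a) ∂μ ≠ ⊤) : Integrable (fun a => max (g a) 0) μ := by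
  have h₀ : 0 ≤ᵐ[μ] fun a => max (g a) (0 : ℝ) := ae_of_all _ fun a => le_max_right _ _
  refine (lintegral_ofReal_ne_top_iff_integrable
    (hg.max aemeasurable_const).aestronglyMeasurable h₀).1 ?_
  have : ∀ a, ENNReal.ofReal (max (g a) 0) = ENNReal.ofReal (g a) := fun a => by
    rw [ENNReal.ofReal_max, ENNReal.ofReal_zero]
    exact max_eq_left (zero_le)
  simpa only [this] using h

lemma integrable_of_lintegral_parts {g : α → ℝ} (hg : AEMeasurable g μ)
    (h₁ : ∫⁻ a, ENNReal.ofReal (g a) ∂μ ≠ ⊤) (h₂ : ∫⁻ a, ENNReal.ofReal (-g a) ∂μ ≠ ⊤) :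
    Integrable g μ := by
  refine ((integrable_max_zero hg h₁).sub (integrable_max_zero hg.neg h₂)).congr
    (ae_of_all _ fun a => ?_)
  simp only [Pi.sub_apply, Pi.neg_apply]
  rcases le_total (g a) 0 with h | h
  · rw [max_eq_right h, max_eq_left (by linarith)]; ring
  · rw [max_eq_left h, max_eq_right (by linarith)]; ring

lemma extIntegral_coe_of_integrable {g : α → ℝ} (hg : Integrable g μ) :
    extIntegral μ (fun a => (g a : EReal)) = ((∫ a, g a ∂μ : ℝ) : EReal) := by
  have h₁ : ∫⁻ a, ENNReal.ofReal (g a) ∂μ ≠ ⊤ := hg.lintegral_lt_top.ne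
  have h₂ : ∫⁻ a, ENNReal.ofReal (-g a) ∂μ ≠ ⊤ := hg.neg.lintegral_lt_top.ne
  rw [extIntegral_coe, integral_eq_lintegral_pos_part_sub_lintegral_neg_part hg, EReal.coe_sub,
    EReal.coe_ennreal_toReal h₁, EReal.coe_ennreal_toReal h₂]

lemma integrable_of_extIntegral_coe {g : α → ℝ} (hg : AEMeasurable g μ)
    (hbot : extIntegral μ (fun a => (g a : EReal)) ≠ ⊥)
    (htop : extIntegral μ (fun a => (g a : EReal)) ≠ ⊤) : Integrable g μ := by
  rw [extIntegral_coe] at hbot htop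
  have h₂ : ∫⁻ a, ENNReal.ofReal (-g a) ∂μ ≠ ⊤ := by
    intro h
    rw [h, EReal.coe_ennreal_top, EReal.sub_top] at hbot
    exact hbot rfl
  refine integrable_of_lintegral_parts hg (fun h => ?_) h₂
  rw [h, EReal.coe_ennreal_top, ← EReal.coe_ennreal_toReal h₂, EReal.top_sub_coe] at htop
  exact htop rfl

lemma extIntegral_map {β : Type*} [MeasurableSpace β] {X : α → β} (hX : Measurable X)
    {g : β → EReal} (hg : Measurable g) :
    extIntegral (μ.map X) g = extIntegral μ fun a => g (X a) := by
  have hg' : Measurable fun b => (-g b).toENNReal := hg.neg.ereal_toENNReal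
  rw [extIntegral, extIntegral, lintegral_map hg.ereal_toENNReal hX, lintegral_map hg' hX]

lemma extIntegral_congr_ae {g g' : α → EReal} (h : g =ᵐ[μ] g') :
    extIntegral μ g = extIntegral μ g' := by
  have h₁ : ∫⁻ a, (g a).toENNReal ∂μ = ∫⁻ a, (g' a).toENNReal ∂μ :=
    lintegral_congr_ae (h.mono fun a ha => congrArg EReal.toENNReal ha)
  have h₂ : ∫⁻ a, (-g a).toENNReal ∂μ = ∫⁻ a, (-g' a).toENNReal ∂μ :=
    lintegral_congr_ae (h.mono fun a ha => congrArg (fun r : EReal => (-r).toENNReal) ha)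
  rw [extIntegral, extIntegral, h₁, h₂]

lemma coe_finset_sum {ι : Type*} (I : Finset ι) (g : ι → ℝ) :
    ((∑ i ∈ I, g i : ℝ) : EReal) = ∑ i ∈ I, (g i : EReal) :=
  map_sum (⟨⟨Real.toEReal, EReal.coe_zero⟩, EReal.coe_add⟩ : ℝ →+ EReal) g I

/-- Integrates a pointwise inequality without assuming `A` or the `g i` integrable. The bound from
below forces the negative part of `A` to be integrable. So either the integral of `A` is `⊤` and
nothing is to be shown, or `A` is integrable. -/
lemma sum_extIntegral_le {ι : Type*} (I : Finset ι) {g : ι → α → ℝ} {A U : α → ℝ}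
    (hg : ∀ i ∈ I, AEMeasurable (g i) μ) (hA : AEMeasurable A μ) (hU : Integrable U μ)
    (hneg : ∀ i ∈ I, ∫⁻ a, ENNReal.ofReal (-g i a) ∂μ ≠ ⊤)
    (hle : ∀ᵐ a ∂μ, ∑ i ∈ I, g i a ≤ A a + U a) :
    ∑ i ∈ I, extIntegral μ (fun a => (g i a : EReal)) ≤
      extIntegral μ (fun a => (A a : EReal)) + ((∫ a, U a ∂μ : ℝ) : EReal) := by
  classical
  have hn : ∀ i ∈ I, Integrable (fun a => max (-g i a) 0) μ := fun i hi =>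
    integrable_max_zero (hg i hi).neg (hneg i hi)
  have hbound : Integrable (fun a => |U a| + ∑ i ∈ I, max (-g i a) 0) μ :=
    hU.abs.add (integrable_finsetSum _ hn)
  have hAneg : ∫⁻ a, ENNReal.ofReal (-A a) ∂μ ≠ ⊤ := by
    refine ne_top_of_le_ne_top hbound.lintegral_lt_top.ne (lintegral_mono_ae ?_)
    filter_upwards [hle] with a ha
    refine ENNReal.ofReal_le_ofReal ?_
    have h₁ : -∑ i ∈ I, g i a ≤ ∑ i ∈ I, max (-g i a) 0 := by
      rw [← Finset.sum_neg_distrib]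
      exact Finset.sum_le_sum fun i _ => le_max_left _ _
    linarith [le_abs_self (U a)]
  by_cases hAtop : ∫⁻ a, ENNReal.ofReal (A a) ∂μ = ⊤
  · rw [extIntegral_coe A, hAtop, EReal.coe_ennreal_top, ← EReal.coe_ennreal_toReal hAneg,
      EReal.top_sub_coe, EReal.top_add_coe]
    exact le_top
  have hAi := integrable_of_lintegral_parts hA hAtop hAneg
  -- Each `g i` is squeezed: from below by its own negative part, from above by `A + U` plus the
  -- negative parts of the other terms.
  have hgi : ∀ i ∈ I, Integrable (g i) μ := by
    intro i hi
    refine (hAi.abs.add hbound).mono' (hg i hi).aestronglyMeasurable ?_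
    filter_upwards [hle] with a ha
    have h₁ : ∑ j ∈ I, max (-g j a) 0 =
        max (-g i a) 0 + ∑ j ∈ I.erase i, max (-g j a) 0 := (Finset.add_sum_erase I _ hi).symm
    have h₂ : ∑ j ∈ I, g j a = g i a + ∑ j ∈ I.erase i, g j a := (Finset.add_sum_erase I _ hi).symm
    have h₃ : -∑ j ∈ I.erase i, g j a ≤ ∑ j ∈ I.erase i, max (-g j a) 0 := by
      rw [← Finset.sum_neg_distrib]
      exact Finset.sum_le_sum fun j _ => le_max_left _ _
    have h₄ : 0 ≤ ∑ j ∈ I.erase i, max (-g j a) 0 := Finset.sum_nonneg fun _ _ => le_max_right _ _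
    have h₅ := le_max_left (-g i a) 0
    have h₆ := le_max_right (-g i a) 0
    rw [Real.norm_eq_abs, abs_le, Pi.add_apply]
    constructor <;>
      linarith [le_abs_self (U a), le_abs_self (A a), abs_nonneg (U a), abs_nonneg (A a)]
  rw [Finset.sum_congr rfl fun i hi => extIntegral_coe_of_integrable (hgi i hi),
    extIntegral_coe_of_integrable hAi, ← EReal.coe_add, ← coe_finset_sum, EReal.coe_le_coe_iff,
    ← integral_finsetSum _ hgi, ← integral_add hAi hU]
  exact integral_mono_ae (integrable_finsetSum _ hgi) (hAi.add hU) hle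

lemma measurable_log2Abs : Measurable log2Abs := by
  unfold log2Abs
  refine Measurable.ite (measurableSet_singleton 0) measurable_const ?_
  exact ((Real.measurable_log.comp measurable_norm).div_const _).coe_real_ereal

/-- A value other than `⊥` means that the negative part has finite integral. As that part is
infinite where `J` vanishes, `J` is nonzero almost everywhere and real logarithms may be used. -/
lemma extIntegral_log2Abs {J : α → ℝ} (hJ : Measurable J)
    (h : extIntegral μ (fun a => log2Abs (J a)) ≠ ⊥) :
    (∀ᵐ a ∂μ, J a ≠ 0) ∧ ∫⁻ a, ENNReal.ofReal (-Real.logb 2 |J a|) ∂μ ≠ ⊤ ∧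
      extIntegral μ (fun a => log2Abs (J a)) =
        extIntegral μ fun a => ((Real.logb 2 |J a| : ℝ) : EReal) := by
  have hm : Measurable fun a => (-log2Abs (J a)).toENNReal :=
    (measurable_log2Abs.comp hJ).neg.ereal_toENNReal
  have hfin : ∫⁻ a, (-log2Abs (J a)).toENNReal ∂μ ≠ ⊤ := by
    intro htop
    rw [extIntegral, htop, EReal.coe_ennreal_top, EReal.sub_top] at h
    exact h rfl
  have hae : ∀ᵐ a ∂μ, J a ≠ 0 := by
    filter_upwards [ae_lt_top hm hfin] with a ha h0
    simp [log2Abs, h0] at ha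
  have heq : ∀ᵐ a ∂μ, log2Abs (J a) = ((Real.logb 2 |J a| : ℝ) : EReal) :=
    hae.mono fun a ha => if_neg ha
  refine ⟨hae, ?_, extIntegral_congr_ae heq⟩
  convert hfin using 1
  refine lintegral_congr_ae (heq.mono fun a ha => ?_)
  simp only [ha, ← EReal.coe_neg, EReal.toENNReal_of_ne_top (EReal.coe_ne_top _), EReal.toReal_coe]

end ExtIntegral

/-! ### Differential entropy as an expectation. -/

section DiffEntropy

variable {Ω : Type*} [MeasurableSpace Ω] {P : Measure Ω} [IsProbabilityMeasure P] {n : ℕ}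

lemma absolutelyContinuous_of_diffEntropy_ne_bot {μ : Measure (Vec n)}
    (h : diffEntropy μ ≠ ⊥) : μ ≪ volume := by
  by_contra hμ
  exact h (if_neg hμ)

lemma lintegral_density_comp {X : Ω → Vec n} (hX : Measurable X) (hac : P.map X ≪ volume)
    {ψ : ℝ → ℝ} (hψ : Measurable ψ) :
    ∫⁻ y, ENNReal.ofReal (((P.map X).rnDeriv volume y).toReal *
        ψ ((P.map X).rnDeriv volume y).toReal) =
      ∫⁻ ω, ENNReal.ofReal (ψ ((P.map X).rnDeriv volume (X ω)).toReal) ∂P := by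
  have : IsProbabilityMeasure (P.map X) := Measure.isProbabilityMeasure_map hX.aemeasurable
  have hm : Measurable fun y => ENNReal.ofReal (ψ ((P.map X).rnDeriv volume y).toReal) :=
    (hψ.comp (Measure.measurable_rnDeriv _ _).ennreal_toReal).ennreal_ofReal
  rw [← lintegral_map hm hX, ← lintegral_rnDeriv_mul hac hm.aemeasurable]
  refine lintegral_congr_ae ?_
  filter_upwards [Measure.rnDeriv_lt_top (P.map X) volume] with y hy
  rw [ENNReal.ofReal_mul ENNReal.toReal_nonneg, ENNReal.ofReal_toReal hy.ne]

lemma diffEntropy_map {X : Ω → Vec n} (hX : Measurable X) (hac : P.map X ≪ volume) :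
    diffEntropy (P.map X) = extIntegral P fun ω =>
      ((-Real.log ((P.map X).rnDeriv volume (X ω)).toReal / Real.log 2 : ℝ) : EReal) := by
  have hψ : Measurable fun r : ℝ => -Real.log r / Real.log 2 :=
    Real.measurable_log.neg.div_const _
  have hψ' : Measurable fun r : ℝ => -(-Real.log r / Real.log 2) := hψ.neg
  rw [diffEntropy, if_pos hac, extIntegral_coe, extIntegral_coe,
    ← lintegral_density_comp hX hac hψ, ← lintegral_density_comp hX hac hψ']
  simp only [Real.negMulLog, mul_div_assoc', neg_mul, mul_neg, neg_div]

lemma ae_rnDeriv_comp_ne {X : Ω → Vec n} (hX : Measurable X) (hac : P.map X ≪ volume) :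
    ∀ᵐ ω ∂P, (P.map X).rnDeriv volume (X ω) ≠ 0 ∧ (P.map X).rnDeriv volume (X ω) ≠ ⊤ := by
  have : IsProbabilityMeasure (P.map X) := Measure.isProbabilityMeasure_map hX.aemeasurable
  refine ae_of_ae_map hX.aemeasurable (p := fun y => (P.map X).rnDeriv volume y ≠ 0 ∧
    (P.map X).rnDeriv volume y ≠ ⊤) ?_
  filter_upwards [Measure.rnDeriv_pos hac, hac.ae_le (Measure.rnDeriv_lt_top (P.map X) volume)]
    with y h₁ h₂
  exact ⟨h₁.ne', h₂.ne⟩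

end DiffEntropy

/-! ### The entropy balance at a finite horizon. -/

section ClosedLoop

variable {N d s : ℕ} {M M' : Type*} [Fintype M] [MeasurableSpace M] [MeasurableSingletonClass M]
  [Fintype M'] [MeasurableSpace M'] [MeasurableSingletonClass M']
  {Ω : Type*} [MeasurableSpace Ω] {P : Measure Ω} [IsProbabilityMeasure P]
  {f : Vec N → Vec d → Vec N} {B : Matrix (Fin N) (Fin s) ℝ} {ν : Measure (Vec d)}
  {ch : Channel M M'} {γe : CodingPolicy N M M'} {γ : ControlPolicy s M'}
  {x : ℕ → Ω → Vec N} {w : ℕ → Ω → Vec d} {q : ℕ → Ω → M} {q' : ℕ → Ω → M'}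

lemma massAt_history_succ (t : ℕ) (ω : Ω) :
    massAt P (fun ω => (q' t ω, history q' t ω)) ω = massAt P (history q' (t + 1)) ω := by
  have hset : (fun ω => (q' t ω, history q' t ω)) ⁻¹' {(q' t ω, history q' t ω)} =
      history q' (t + 1) ⁻¹' {history q' (t + 1) ω} := by
    ext ω'
    simp only [Set.mem_preimage, Set.mem_singleton_iff, Prod.mk.injEq, funext_iff, history]
    rw [Fin.forall_fin_succ']
    exact and_comm
  rw [massAt, massAt, hset]

lemma massAt_history_zero (ω : Ω) : massAt P (history q' 0) ω = 1 := by
  have hset : history q' 0 ⁻¹' {history q' 0 ω} = Set.univ :=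
    Set.eq_univ_of_forall fun ω' => Subsingleton.elim _ _
  rw [massAt, hset, probReal_univ]

lemma massAt_history (T : ℕ) (ω : Ω) :
    massAt P (history q' T) ω = (P {ω' | ∀ i < T, q' i ω' = q' i ω}).toReal := by
  have hset : history q' T ⁻¹' {history q' T ω} = {ω' | ∀ i < T, q' i ω' = q' i ω} := by
    ext ω'
    simp only [Set.mem_preimage, Set.mem_singleton_iff, funext_iff, history, Set.mem_ofPred_eq]
    exact ⟨fun h i hi => h ⟨i, hi⟩, fun h i => h i i.2⟩
  rw [massAt, hset, measureReal_def]

namespace IsClosedLoop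

lemma pathProb_source (h : IsClosedLoop P f B ν ch γe γ x w q q') (T : ℕ) (ω : Ω) :
    pathProb f B ch γe γ (fun i => q' i ω) (source x w ω) T =
      ∏ t ∈ Finset.range T, ch t (history q (t + 1) ω) (history q' t ω) (q' t ω) := by
  refine Finset.prod_congr rfl fun t _ => ?_
  have hq : history q (t + 1) ω = fun i : Fin (t + 1) =>
      inputOf f B γe γ (fun i => q' i ω) (source x w ω) i :=
    funext fun i => h.input_eq_inputOf i ω
  rw [hq]; rfl

/-- The channel factors multiply to the path probability, and the output masses telescope from the
empty history, of mass 1. Almost sure positivity of the path probability allows the logarithm of the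
product to be split. -/
lemma directedInfo_eq_integral (h : IsClosedLoop P f B ν ch γe γ x w q q')
    (hf : Measurable (Function.uncurry f)) (hγe : ∀ t, Measurable (Function.uncurry (γe t)))
    (T : ℕ) :
    Integrable (fun ω =>
        (Real.log (pathProb f B ch γe γ (fun i => q' i ω) (source x w ω) T).toReal -
          Real.log (massAt P (history q' T) ω)) / Real.log 2) P ∧
      directedInfo P q q' T = ∫ ω,
        (Real.log (pathProb f B ch γe γ (fun i => q' i ω) (source x w ω) T).toReal -
          Real.log (massAt P (history q' T) ω)) / Real.log 2 ∂P := by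
  have hq := measurable_history (h.measurable_input hf hγe)
  have hq' := measurable_history h.measurable_output
  set D : ℕ → Ω → ℝ := fun t ω =>
    (Real.log (ch t (history q (t + 1) ω) (history q' t ω) (q' t ω)).toReal +
      Real.log (massAt P (history q' t) ω) -
      Real.log (massAt P (history q' (t + 1)) ω)) / Real.log 2 with hD
  have hDi : ∀ t, Integrable (D t) P := by
    intro t
    have h₁ := integrable_comp_of_fintype (P := P)
      ((hq (t + 1)).prodMk ((hq' t).prodMk (h.measurable_output t)))
      fun a => Real.log (ch t a.1 a.2.1 a.2.2).toReal
    exact ((h₁.add (integrable_log_massAt (hq' t))).sub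
      (integrable_log_massAt (hq' (t + 1)))).div_const _
  have hDI : directedInfo P q q' T = ∫ ω, ∑ t ∈ Finset.range T, D t ω ∂P := by
    rw [integral_finsetSum _ fun t _ => hDi t, directedInfo]
    refine Finset.sum_congr rfl fun t _ => ?_
    rw [condMutualInfo_eq_integral (hq (t + 1)) (h.measurable_output t) (hq' t)
      (fun a u b => (ch t a u b).toReal) (h.real_output hf hγe t)]
    simp only [massAt_history_succ, hD]
  have hae : ∀ᵐ ω ∂P, ∑ t ∈ Finset.range T, D t ω =
      (Real.log (pathProb f B ch γe γ (fun i => q' i ω) (source x w ω) T).toReal -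
        Real.log (massAt P (history q' T) ω)) / Real.log 2 := by
    filter_upwards [h.ae_pathProb_ne_zero hf hγe T] with ω hω
    rw [h.pathProb_source, Finset.prod_ne_zero_iff] at hω
    have hne : ∀ t ∈ Finset.range T,
        (ch t (history q (t + 1) ω) (history q' t ω) (q' t ω)).toReal ≠ 0 := fun t ht =>
      ENNReal.toReal_ne_zero.2 ⟨hω t ht, PMF.apply_ne_top _ _⟩
    rw [h.pathProb_source, ENNReal.toReal_prod, Real.log_prod hne, ← Finset.sum_div]
    simp only [add_sub_assoc, Finset.sum_add_distrib]
    rw [Finset.sum_range_sub' fun t => Real.log (massAt P (history q' t) ω),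
      massAt_history_zero, Real.log_one, zero_sub, sub_eq_add_neg]
  exact ⟨(integrable_finsetSum _ fun t _ => hDi t).congr hae, hDI.trans (integral_congr_ae hae)⟩

lemma expLogJacobian_eq (h : IsClosedLoop P f B ν ch γe γ x w q q')
    (hf : Measurable (Function.uncurry f)) (hf_diff : ∀ v, ContDiff ℝ 1 fun y => f y v)
    (hγe : ∀ t, Measurable (Function.uncurry (γe t))) (t : ℕ) :
    expLogJacobian f (P.map (x t)) ν =
      extIntegral P fun ω => log2Abs (jacobian f (x t ω) (w t ω)) := by
  rw [expLogJacobian, ← h.map_state_noise hf hγe t]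
  exact extIntegral_map ((h.measurable_state hf t).prodMk (h.measurable_noise t))
    (measurable_log2Abs.comp (measurable_jacobian hf hf_diff))

lemma pathJacobian_source (h : IsClosedLoop P f B ν ch γe γ x w q q') (T : ℕ) (ω : Ω) :
    pathJacobian f B γ (fun i => q' i ω) (source x w ω) T =
      ∏ t ∈ Finset.range T, ENNReal.ofReal |jacobian f (x t ω) (w t ω)| := by
  refine Finset.prod_congr rfl fun t _ => ?_
  rw [h.state_eq_stateOf]; rfl

lemma ae_ratio_ne_zero (h : IsClosedLoop P f B ν ch γe γ x w q q')
    (hx₀ : P.map (x 0) ≪ volume) (T : ℕ)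
    (hJ : ∀ᵐ ω ∂P, ∀ t ∈ Finset.range T, jacobian f (x t ω) (w t ω) ≠ 0) :
    ∀ᵐ ω ∂P, ratio P f B ch γe γ x q' T (fun i => q' i ω) (source x w ω) ≠ 0 := by
  filter_upwards [hJ, ae_massAt_ne_zero (P := P) (history q' T),
    ae_rnDeriv_comp_ne h.measurable_init hx₀] with ω hω hmass hp
  rw [massAt_history, ENNReal.toReal_ne_zero] at hmass
  refine mul_ne_zero (mul_ne_zero (mul_ne_zero ?_ hmass.1) (ENNReal.inv_ne_zero.2 hp.2)) ?_
  · rw [h.pathJacobian_source, Finset.prod_ne_zero_iff]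
    exact fun t ht => (ENNReal.ofReal_pos.2 (abs_pos.2 (hω t ht))).ne'
  · rw [ENNReal.inv_ne_zero, h.pathProb_source]
    exact ENNReal.prod_ne_top fun t _ => PMF.apply_ne_top _ _

lemma measurable_ratio_comp (h : IsClosedLoop P f B ν ch γe γ x w q q')
    (hf : Measurable (Function.uncurry f)) (hf_diff : ∀ v, ContDiff ℝ 1 fun y => f y v)
    (hγe : ∀ t, Measurable (Function.uncurry (γe t))) (T : ℕ) :
    Measurable fun ω => ratio P f B ch γe γ x q' T (fun i => q' i ω) (source x w ω) :=
  h.measurable_comp_outputs T (measurable_ratio hf hf_diff hγe T) fun _ _ z hb => ratio_congr hb z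

/-- For a Lebesgue-null set the ratio bound has right side 0, while the ratio is almost surely
positive, so the state almost surely avoids the set. Without this, the entropy of `x T` could be `⊥`
with a finite left side in the balance below. -/
lemma absolutelyContinuous_map_state (h : IsClosedLoop P f B ν ch γe γ x w q q')
    (hf : Measurable (Function.uncurry f)) (hf_diff : ∀ v, ContDiff ℝ 1 fun y => f y v)
    (hf_inv : ∀ v, Function.Bijective fun y => f y v)
    (hγe : ∀ t, Measurable (Function.uncurry (γe t)))
    (hx₀ : P.map (x 0) ≪ volume) (T : ℕ)
    (hJ : ∀ᵐ ω ∂P, ∀ t ∈ Finset.range T, jacobian f (x t ω) (w t ω) ≠ 0) :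
    P.map (x T) ≪ volume := by
  refine Measure.AbsolutelyContinuous.mk fun A hA hA0 => ?_
  have hxT := h.measurable_state hf T
  have hA1 : Measurable (A.indicator (1 : Vec N → ENNReal)) := measurable_one.indicator hA
  have hle := h.lintegral_state_mul_ratio_le hf hf_diff hf_inv hγe hx₀ T hA1
  have hm : Measurable fun ω => A.indicator (1 : Vec N → ENNReal) (x T ω) *
      ratio P f B ch γe γ x q' T (fun i => q' i ω) (source x w ω) :=
    (hA1.comp hxT).mul (h.measurable_ratio_comp hf hf_diff hγe T)
  rw [lintegral_indicator_one hA, hA0, nonpos_iff_eq_zero, lintegral_eq_zero_iff hm] at hle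
  rw [Measure.map_apply hxT hA, measure_eq_zero_iff_ae_notMem]
  filter_upwards [hle, h.ae_ratio_ne_zero hx₀ T hJ] with ω h₁ h₂ hω
  rw [Set.indicator_of_mem (by exact hω), Pi.one_apply, one_mul] at h₁
  exact h₂ h₁

lemma sum_expLogJacobian_le (h : IsClosedLoop P f B ν ch γe γ x w q q')
    (hf : Measurable (Function.uncurry f)) (hf_diff : ∀ v, ContDiff ℝ 1 fun y => f y v)
    (hf_inv : ∀ v, Function.Bijective fun y => f y v)
    (hγe : ∀ t, Measurable (Function.uncurry (γe t)))
    (hbot : diffEntropy (P.map (x 0)) ≠ ⊥) (htop : diffEntropy (P.map (x 0)) ≠ ⊤) (T : ℕ) :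
    ∑ t ∈ Finset.range T, expLogJacobian f (P.map (x t)) ν ≤
      diffEntropy (P.map (x T)) +
        ((directedInfo P q q' T - (diffEntropy (P.map (x 0))).toReal : ℝ) : EReal) := by
  -- A single `⊥` term makes the whole sum `⊥`; otherwise every Jacobian is almost surely nonzero.
  by_cases hexp : ∃ t ∈ Finset.range T, expLogJacobian f (P.map (x t)) ν = ⊥
  · obtain ⟨t, ht, htb⟩ := hexp
    rw [← Finset.add_sum_erase _ _ ht, htb, EReal.bot_add]
    exact bot_le
  push Not at hexp
  have hJm : ∀ t, Measurable fun ω => jacobian f (x t ω) (w t ω) := fun t =>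
    (measurable_jacobian hf hf_diff).comp ((h.measurable_state hf t).prodMk (h.measurable_noise t))
  have hlog := fun t (ht : t ∈ Finset.range T) => extIntegral_log2Abs (μ := P) (hJm t)
    (h.expLogJacobian_eq hf hf_diff hγe t ▸ hexp t ht)
  have hJ : ∀ᵐ ω ∂P, ∀ t ∈ Finset.range T, jacobian f (x t ω) (w t ω) ≠ 0 :=
    (Finset.eventually_all _).2 fun t ht => (hlog t ht).1
  have hx₀ := absolutelyContinuous_of_diffEntropy_ne_bot hbot
  have hxT := h.absolutelyContinuous_map_state hf hf_diff hf_inv hγe hx₀ T hJ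
  have hXT := h.measurable_state hf T
  set p₀ := (P.map (x 0)).rnDeriv volume
  set pT := (P.map (x T)).rnDeriv volume
  set K : Ω → ENNReal := fun ω => pathProb f B ch γe γ (fun i => q' i ω) (source x w ω) T with hK
  set R : Ω → ENNReal := fun ω =>
    pT (x T ω) * ratio P f B ch γe γ x q' T (fun i => q' i ω) (source x w ω) with hR
  have hpTm : Measurable pT := Measure.measurable_rnDeriv _ _
  have hRm : Measurable R := (hpTm.comp hXT).mul (h.measurable_ratio_comp hf hf_diff hγe T)
  have hR1 : ∫⁻ ω, R ω ∂P ≤ 1 := by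
    refine (h.lintegral_state_mul_ratio_le hf hf_diff hf_inv hγe hx₀ T hpTm).trans ?_
    refine (Measure.lintegral_rnDeriv_le).trans ?_
    rw [Measure.map_apply hXT MeasurableSet.univ]
    exact prob_le_one
  have hRi : Integrable (fun ω => (R ω).toReal) P := integrable_toReal_of_lintegral_ne_top
    hRm.aemeasurable (ne_top_of_le_ne_top ENNReal.one_ne_top hR1)
  have hRint : ∫ ω, (R ω).toReal ∂P ≤ 1 := by
    rw [integral_toReal hRm.aemeasurable
      (ae_lt_top hRm (ne_top_of_le_ne_top ENNReal.one_ne_top hR1))]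
    exact ENNReal.toReal_le_of_le_ofReal zero_le_one (by simpa using hR1)
  obtain ⟨hIi, hI⟩ := h.directedInfo_eq_integral hf hγe T
  have h0 := diffEntropy_map h.measurable_init hx₀
  have h0m : Measurable fun ω => -Real.log (p₀ (x 0 ω)).toReal / Real.log 2 :=
    (Real.measurable_log.comp ((Measure.measurable_rnDeriv _ _).comp
      h.measurable_init).ennreal_toReal).neg.div_const _
  have hTm : Measurable fun ω => -Real.log (pT (x T ω)).toReal / Real.log 2 :=
    (Real.measurable_log.comp (hpTm.comp hXT).ennreal_toReal).neg.div_const _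
  have h0i : Integrable (fun ω => -Real.log (p₀ (x 0 ω)).toReal / Real.log 2) P :=
    integrable_of_extIntegral_coe h0m.aemeasurable (h0 ▸ hbot) (h0 ▸ htop)
  rw [extIntegral_coe_of_integrable h0i] at h0
  have hlog2 : 0 < Real.log 2 := Real.log_pos one_lt_two
  have hi : Integrable (fun ω => (Real.log (K ω).toReal -
      Real.log (massAt P (history q' T) ω)) / Real.log 2 -
      -Real.log (p₀ (x 0 ω)).toReal / Real.log 2) P := hIi.sub h0i
  have hRi' : Integrable (fun ω => ((R ω).toReal - 1) / Real.log 2) P :=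
    (hRi.sub (integrable_const 1)).div_const _
  -- All terms of the pointwise bound except the log-density of `x T` are integrable and are grouped
  -- into one function; the entropy of `x T` stays separate because it may be `⊤`.
  have hUi : Integrable (fun ω => (Real.log (K ω).toReal -
      Real.log (massAt P (history q' T) ω)) / Real.log 2 -
      -Real.log (p₀ (x 0 ω)).toReal / Real.log 2 + ((R ω).toReal - 1) / Real.log 2) P :=
    hi.add hRi'
  have hU : ∫ ω, ((Real.log (K ω).toReal -
      Real.log (massAt P (history q' T) ω)) / Real.log 2 -
      -Real.log (p₀ (x 0 ω)).toReal / Real.log 2 + ((R ω).toReal - 1) / Real.log 2) ∂P ≤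
      directedInfo P q q' T - (diffEntropy (P.map (x 0))).toReal := by
    have hR0 : ∫ ω, ((R ω).toReal - 1) / Real.log 2 ∂P ≤ 0 := by
      rw [integral_div, integral_sub hRi (integrable_const 1), integral_const, probReal_univ,
        one_smul]
      exact div_nonpos_of_nonpos_of_nonneg (by linarith) hlog2.le
    rw [integral_add hi hRi', integral_sub hIi h0i, ← hI, h0, EReal.toReal_coe]
    linarith
  have hle : ∀ᵐ ω ∂P, ∑ t ∈ Finset.range T, Real.logb 2 |jacobian f (x t ω) (w t ω)| ≤
      -Real.log (pT (x T ω)).toReal / Real.log 2 + ((Real.log (K ω).toReal -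
      Real.log (massAt P (history q' T) ω)) / Real.log 2 -
      -Real.log (p₀ (x 0 ω)).toReal / Real.log 2 + ((R ω).toReal - 1) / Real.log 2) := by
    filter_upwards [hJ, ae_massAt_ne_zero (P := P) (history q' T),
      ae_rnDeriv_comp_ne h.measurable_init hx₀, ae_rnDeriv_comp_ne hXT hxT,
      h.ae_pathProb_ne_zero hf hγe T] with ω hω hmass hp0 hpT' hK0
    have hKtop : K ω ≠ ⊤ := by
      simp only [hK, h.pathProb_source]
      exact ENNReal.prod_ne_top fun t _ => PMF.apply_ne_top _ _
    have hKr : (K ω).toReal ≠ 0 := ENNReal.toReal_ne_zero.2 ⟨hK0, hKtop⟩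
    have hp0r : (p₀ (x 0 ω)).toReal ≠ 0 := ENNReal.toReal_ne_zero.2 hp0
    have hpTr : (pT (x T ω)).toReal ≠ 0 := ENNReal.toReal_ne_zero.2 hpT'
    have hJr : ∀ t ∈ Finset.range T, |jacobian f (x t ω) (w t ω)| ≠ 0 := fun t ht =>
      abs_ne_zero.2 (hω t ht)
    have hJp := Finset.prod_ne_zero_iff.2 hJr
    have hRr : (R ω).toReal = (pT (x T ω)).toReal *
        ((∏ t ∈ Finset.range T, |jacobian f (x t ω) (w t ω)|) * massAt P (history q' T) ω *
          (p₀ (x 0 ω)).toReal⁻¹ * (K ω).toReal⁻¹) := by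
      simp only [hR, ratio, ENNReal.toReal_mul, ENNReal.toReal_inv, massAt_history,
        h.pathJacobian_source, ENNReal.toReal_prod, ENNReal.toReal_ofReal (abs_nonneg _)]
      rfl
    have hRne : (R ω).toReal ≠ 0 := by
      rw [hRr]
      exact mul_ne_zero hpTr (mul_ne_zero (mul_ne_zero (mul_ne_zero hJp hmass)
        (inv_ne_zero hp0r)) (inv_ne_zero hKr))
    -- The pointwise form of Jensen's inequality: only the left occurrence of `R` is expanded into
    -- its factors, the right one being integrated through E[R] ≤ 1.
    have hlogR := Real.log_le_sub_one_of_pos (lt_of_le_of_ne ENNReal.toReal_nonneg hRne.symm)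
    nth_rewrite 1 [hRr] at hlogR
    rw [Real.log_mul hpTr (mul_ne_zero (mul_ne_zero (mul_ne_zero hJp hmass)
        (inv_ne_zero hp0r)) (inv_ne_zero hKr)),
      Real.log_mul (mul_ne_zero (mul_ne_zero hJp hmass) (inv_ne_zero hp0r)) (inv_ne_zero hKr),
      Real.log_mul (mul_ne_zero hJp hmass) (inv_ne_zero hp0r), Real.log_mul hJp hmass,
      Real.log_prod hJr, Real.log_inv, Real.log_inv] at hlogR
    simp only [Real.logb]
    rw [← Finset.sum_div, ← sub_div, ← add_div, ← add_div]
    refine div_le_div_of_nonneg_right ?_ hlog2.le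
    linarith
  have hmain := sum_extIntegral_le (μ := P) (Finset.range T)
    (g := fun t ω => Real.logb 2 |jacobian f (x t ω) (w t ω)|)
    (fun t _ => ((Real.measurable_log.comp (measurable_norm.comp (hJm t))).div_const
      (Real.log 2)).aemeasurable)
    hTm.aemeasurable hUi (fun t ht => (hlog t ht).2.1) hle
  rw [Finset.sum_congr rfl fun t ht =>
    (h.expLogJacobian_eq hf hf_diff hγe t).trans (hlog t ht).2.2, diffEntropy_map hXT hxT]
  exact hmain.trans (add_le_add_right (EReal.coe_le_coe_iff.2 hU) _)

end IsClosedLoop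

end ClosedLoop

/-! ### Passage to the limit in the extended reals. -/

lemma limsup_div_le_of_le_add {a H : ℕ → EReal} {I : ℕ → ℝ} (c : ℝ)
    (h : ∀ T, a T ≤ H T + ((I T - c : ℝ) : EReal))
    (hH : limsup (fun T : ℕ => H T / (T : EReal)) atTop ≤ 0) :
    limsup (fun T : ℕ => a T / (T : EReal)) atTop ≤
      limsup (fun T : ℕ => ((I T : ℝ) : EReal) / (T : EReal)) atTop := by
  set L := limsup (fun T : ℕ => ((I T : ℝ) : EReal) / (T : EReal)) atTop
  -- Subadditivity of limsup in `EReal` requires excluding `⊤` against `⊥`. With `L ≠ ⊤` and the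
  -- limsup of `H T / T` at most 0, neither summand has limsup `⊤`.
  by_cases hLtop : L = ⊤
  · rw [hLtop]; exact le_top
  have hc : limsup (fun T : ℕ => ((-c : ℝ) : EReal) / (T : EReal)) atTop = 0 := by
    refine Tendsto.limsup_eq ?_
    have h₁ : Tendsto (fun T : ℕ => ((-c / (T : ℝ) : ℝ) : EReal)) atTop (nhds ((0 : ℝ) : EReal)) :=
      (continuous_coe_real_ereal.tendsto 0).comp (tendsto_const_div_atTop_nhds_zero_nat (-c))
    exact h₁
  have hv : limsup ((fun T : ℕ => ((I T : ℝ) : EReal) / (T : EReal)) +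
      fun T : ℕ => ((-c : ℝ) : EReal) / (T : EReal)) atTop ≤ L := by
    refine (EReal.limsup_add_le ?_ ?_).trans ?_
    · right; rw [hc]; exact EReal.zero_ne_top
    · right; rw [hc]; exact EReal.zero_ne_bot
    · rw [hc, add_zero]
  calc limsup (fun T : ℕ => a T / (T : EReal)) atTop
      ≤ limsup ((fun T : ℕ => H T / (T : EReal)) +
          ((fun T : ℕ => ((I T : ℝ) : EReal) / (T : EReal)) +
            fun T : ℕ => ((-c : ℝ) : EReal) / (T : EReal))) atTop := by
        refine limsup_le_limsup (Eventually.of_forall fun T => ?_)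
        have hT : (0 : EReal) ≤ (T : EReal) := by exact_mod_cast Nat.zero_le T
        simp only [Pi.add_apply]
        rw [← EReal.add_div_of_nonneg_right hT, ← EReal.add_div_of_nonneg_right hT,
          ← EReal.coe_add, ← sub_eq_add_neg]
        exact EReal.div_le_div_right_of_nonneg hT (h T)
    _ ≤ 0 + L := by
        refine (EReal.limsup_add_le ?_ ?_).trans (add_le_add hH hv)
        · right; exact fun htop => hLtop (top_le_iff.1 (htop ▸ hv))
        · left; exact fun htop => absurd (htop ▸ hH) (by simp)
    _ = L := zero_add L

end BodeFormula

theorem mainTheorem6 {N d s : ℕ}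
    {M M' : Type*} [Fintype M] [MeasurableSpace M] [MeasurableSingletonClass M]
    [Fintype M'] [MeasurableSpace M'] [MeasurableSingletonClass M']
    {Ω : Type*} [MeasurableSpace Ω] (P : Measure Ω) [IsProbabilityMeasure P]
    (f : BodeFormula.Vec N → BodeFormula.Vec d → BodeFormula.Vec N)
    (B : Matrix (Fin N) (Fin s) ℝ) (ν : Measure (BodeFormula.Vec d))
    (ch : BodeFormula.Channel M M') (γe : BodeFormula.CodingPolicy N M M')
    (γ : BodeFormula.ControlPolicy s M')
    (x : ℕ → Ω → BodeFormula.Vec N) (w : ℕ → Ω → BodeFormula.Vec d)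
    (q : ℕ → Ω → M) (q' : ℕ → Ω → M')
    (hf : Measurable (Function.uncurry f))
    (hf_diff : ∀ v, ContDiff ℝ 1 fun y => f y v)
    (hf_inv : ∀ v, Function.Bijective fun y => f y v)
    (hγe : ∀ t, Measurable (Function.uncurry (γe t)))
    (hloop : BodeFormula.IsClosedLoop P f B ν ch γe γ x w q q')
    (hx₀ : BodeFormula.diffEntropy (P.map (x 0)) ≠ ⊥ ∧
      BodeFormula.diffEntropy (P.map (x 0)) ≠ ⊤)
    (hgrowth : limsup (fun t : ℕ => BodeFormula.diffEntropy (P.map (x t)) / (t : EReal)) atTop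
      ≤ 0) :
    limsup (fun T : ℕ =>
        (∑ t ∈ Finset.range T, BodeFormula.expLogJacobian f (P.map (x t)) ν) / (T : EReal)) atTop
      ≤ limsup (fun T : ℕ =>
        ((BodeFormula.directedInfo P q q' T : ℝ) : EReal) / (T : EReal)) atTop := by
  exact BodeFormula.limsup_div_le_of_le_add (BodeFormula.diffEntropy (P.map (x 0))).toReal
    (fun T => hloop.sum_expLogJacobian_le hf hf_diff hf_inv hγe hx₀.1 hx₀.2 T) hgrowth
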